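/- **Setting.** Fix real parameters $\alpha,\beta,\kappa$ and consider the string of second-order subsystems indexed by $k\in\mathbb Z$, with $t=0,1,2,\dots$ and zero initial state, $$x^1_{k,t+1}=\beta x^1_{k,t}+x^2_{k,t}+w^{x,1}_{k,t},\qquad x^2_{k,t+1}=\alpha\big(x^2_{k,t}+\kappa(x^2_{k-1,t}+x^2_{k+1,t})\big)+w^{x,2}_{k,t}+w^u_{k,t}+u_{k,t},$$ $$y_{k,t}=x^1_{k,t}+w^y_{k,t},\qquad \zeta_{k,t}=(x^1_{k,t},x^2_{k,t},u_{k,t})^T,$$ under causal, linear, time- and space-invariant real output feedback $u_{k,t}=\sum_{\tau\le t}\sum_{j\in\mathbb Z}K_{k-j,t-\tau}\,y_{j,\tau}$ with $\sum_k|K_{k,t}|<\infty$ for each $t$. Let $R,M,N,L$ be the closed-loop maps given by $x=Rw^x+Nw^y$, $u=Mw^x+Lw^y$, and let $\mathcal F(P,K)$ be the closed-loop map from $(w^y,w^u)$ to $\zeta$; each map is identified with its spatio-temporal impulse response $G_{k,t}$. Scalar $\mathcal{RH}_\infty$ is the set of proper rational functions of $z$ with all poles in the open unit disk (real coefficients for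 functions attached to a site $k$, complex ones at a fixed spatial frequency). A spatially invariant map is in $\mathcal{RH}_\infty$ if for every $\theta$ each entry of $\sum_t\sum_k G_{k,t}e^{-ik\theta}z^{-t}$ is. $K$ is internally stabilizing if all closed-loop maps from $w^x,w^u,w^y$ to $x,u,y$ are in $\mathcal{RH}_\infty$. A map has extent at most $E$ if $G_{k,\cdot}=0$ for $|k|>E$, and finite extent if this holds for some $E$. Put $\|G\|_2^2=\sum_k\sum_t\operatorname{tr}(G_{k,t}^TG_{k,t})$; for a column of transfer functions $\|v\|_2^2$ is the sum of the squares of all coefficients of the expansions in powers of $z^{-1}$. **Model-matching data.** For $E\ge 0$, let $T$ be the tridiagonal Toeplitz matrix with $z-\alpha$ on the diagonal and $-\alpha\kappa$ on the two neighbouring diagonals, and $Q$ the pentadiagonal Toeplitz matrix with $(z-\alpha)^2+2(\alpha\kappa)^2$ on the diagonal, $-2\alpha\kappa(z-\alpha)$ at distance $1$ and $(\alpha\kappa)^2$ at distance $2$; the entry in row $i$ and column $j$ depends on $i-j$, columns are indexed by $-(E+1),\dots,E+1$, and the rows of the block of $q$ by $-E_q,\dots,E_q$. With $\delta_k=1$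 for $k=0$ and $0$ otherwise, set - $q=n^1$ and $q=m^2$ ($E_q=E+2$): $V^q=(z-\beta)T$, $h^q_k=-\delta_k$; - $q=n^2$ ($E_q=E+2$): $V^q=(z-\beta)^2T$, $h^q_k=-(z-\beta)\delta_k$; - $q=r^{12}$ ($E_q=E+1$): $V^q=I$, $h^q=0$; - $q=r^{22}$ ($E_q=E+1$): $V^q=(z-\beta)I$, $h^q=0$; - $q=\ell$ ($E_q=E+3$): $V^q=(z-\beta)^2Q$, $h^q_k=(z-\beta)\big((\alpha-z)\delta_k+\alpha\kappa(\delta_{k-1}+\delta_{k+1})\big)$. Let $V$ and $h$ be the stacks of the $V^q$ and the $h^q$ in the order $n^1,r^{12},n^2,r^{22},\ell,m^2$, and $$S=z^{-4}\begin{bmatrix}0\\ I_{2E+1}\\ 0\end{bmatrix},\qquad g_k=z^{-3}\big((z+\alpha+\beta)\delta_k+\alpha\kappa(\delta_{k-1}+\delta_{k+1})\big),\qquad V^{\rm SL}_E=VS,\qquad h^{\rm SL}_E=Vg+h.$$ For a controller $K$ define its parameter $f=(f_k)_{k\in\mathbb Z}$ by $r^{12}_k=g_k+z^{-4}f_k$,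 where $r^{12}$ is the $(1,2)$ entry of $R$; at spatial frequency $\theta$ this reads $r^{12}=z^{-2}+z^{-3}(\sigma+\beta)+z^{-4}f$ with $\sigma=\alpha(1+2\kappa\cos\theta)$. Call $K$ *feasible* if it is internally stabilizing and $R,M,N,L$ all have finite extent, and *$E$-feasible* if, moreover, its parameter $f$ has extent at most $E$. **Theorem.** The problem $\inf\|\mathcal F(P,K)\|_2$ over feasible $K$ is equivalent to the unconstrained convex problems $\inf_{f\in\mathcal{RH}_\infty^{2E+1}}\|V^{\rm SL}_Ef+h^{\rm SL}_E\|_2^2$ in the following sense. 1. $K$ is feasible if and only if it is $E$-feasible for some $E$, and $$\Big(\inf_{K\text{ feasible}}\|\mathcal F(P,K)\|_2\Big)^2=\inf_{E\ge0}\ \inf_{f\in\mathcal{RH}_\infty^{2E+1}}\|V^{\rm SL}_Ef+h^{\rm SL}_E\|_2^2 .$$ 2. For every $E\ge 0$, the map $K\mapsto(f_k)_{|k|\le E}$ is a bijection from the $E$-feasible controllers onto $\mathcal{RH}_\infty^{2E+1}$; it satisfies $\|\mathcal F(P,K)\|_2^2=\|V^{\rm SL}_Ef+h^{\rm SL}_E\|_2^2$,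 and hence $$\Big(\inf_{K\ E\text{-feasible}}\|\mathcal F(P,K)\|_2\Big)^2=\inf_{f\in\mathcal{RH}_\infty^{2E+1}}\|V^{\rm SL}_Ef+h^{\rm SL}_E\|_2^2 .$$ 3. For an $E$-feasible $K$, $R$ and $N$ have extent at most $\max\{E+1,2\}$, and $M$ and $L$ have extent at most $\max\{E+2,3\}$. If $E\ge1$ and $\alpha\kappa\ne0$, then $K$ is $E$-feasible if and only if it is internally stabilizing, $R,N$ have extent at most $E+1$, and $M,L$ have extent at most $E+2$. 4. For every $E\ge0$ the cost $f\mapsto\|V^{\rm SL}_Ef+h^{\rm SL}_E\|_2^2$ is finite and convex on $\mathcal{RH}_\infty^{2E+1}$. -/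

import Mathlib

open scoped ENNReal

noncomputable section

namespace SpatialSL

/-! ### Transfer functions

A transfer function is represented by its expansion in powers of `z⁻¹`, i.e. by a Laurent series
whose formal variable stands for `z⁻¹`; the coefficient of index `t` is the value of the impulse
response at time `t`. -/

/-- The temporal frequency variable `z`. -/
def zVar (𝕜 : Type*) [Field 𝕜] : LaurentSeries 𝕜 := HahnSeries.single (-1 : ℤ) (1 : 𝕜)

/-- The temporal transform `∑ₜ gₜ z⁻ᵗ` of a causal sequence. -/
def zTransform {𝕜 : Type*} [Field 𝕜] (g : ℕ → 𝕜) : LaurentSeries 𝕜 :=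
  HahnSeries.ofPowerSeries ℤ 𝕜 (PowerSeries.mk g)

/-- Scalar `RH∞`: the causal (proper), stable, rational transfer functions `N(z) / D(z)`, where
stable means that all zeros of `D` lie in the open unit disk. -/
def RHinf (𝕜 : Type*) [Field 𝕜] [Algebra 𝕜 ℂ] : Set (LaurentSeries 𝕜) :=
  {G | ∃ N D : Polynomial 𝕜, N.degree ≤ D.degree ∧
      (∀ s : ℂ, Polynomial.aeval s D = 0 → ‖s‖ < 1) ∧
      Polynomial.aeval (zVar 𝕜) D * G = Polynomial.aeval (zVar 𝕜) N}

/-! ### Spatially invariant systems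

A scalar causal LTSI system is given by its spatio-temporal impulse response `G k t`, with spatial
index `k : ℤ` and time `t : ℕ`. -/

/-- The spatial Fourier transform `∑ₖ G k t e^{-ikθ}`, for each time `t`. -/
def spatialTransform (G : ℤ → ℕ → ℝ) (θ : ℝ) (t : ℕ) : ℂ :=
  ∑' k : ℤ, (G k t : ℂ) * Complex.exp (-(Complex.I * k * θ))

/-- A scalar LTSI system is in `RH∞` if its transfer function is causal, stable and rational at
every spatial frequency. -/
def IsRHinf (G : ℤ → ℕ → ℝ) : Prop :=
  (∀ t, Summable fun k => G k t) ∧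
    ∀ θ : ℝ, zTransform (spatialTransform G θ) ∈ RHinf ℂ

/-- `G` has extent `E`: site `i` is not influenced by site `j` when `|i - j| > E`. -/
def HasExtent {X : Type*} [Zero X] (E : ℕ) (G : ℤ → X) : Prop :=
  ∀ k : ℤ, (E : ℤ) < |k| → G k = 0

/-- `ext(G) < ∞`. -/
def FiniteExtent {X : Type*} [Zero X] (G : ℤ → X) : Prop :=
  ∃ E : ℕ, HasExtent E G

/-- The squared 2-norm `∑ₖ ∑ₜ trace (Gₖₜᵀ Gₖₜ)` of a matrix-valued LTSI system. -/
def systemNormSq {m n : Type*} [Fintype m] [Fintype n] (G : ℤ → ℕ → Matrix m n ℝ) : ℝ≥0∞ :=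
  ∑' k : ℤ, ∑' t : ℕ, ENNReal.ofReal ((G k t).transpose * G k t).trace

/-- The 2-norm of a matrix-valued LTSI system. -/
def systemNorm {m n : Type*} [Fintype m] [Fintype n] (G : ℤ → ℕ → Matrix m n ℝ) : ℝ≥0∞ :=
  systemNormSq G ^ (1 / 2 : ℝ)

/-- The squared 2-norm of a finite column of transfer functions: the sum of the squares of all
the coefficients of the expansions in powers of `z⁻¹`. -/
def columnNormSq {ι : Type*} [Fintype ι] (v : ι → LaurentSeries ℝ) : ℝ≥0∞ :=
  ∑ i, ∑' t : ℤ, ENNReal.ofReal ((v i).coeff t ^ 2)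

/-! ### The plant and the feedback loop -/

/-- A causal LTSI output feedback controller `u = K y`, given by its impulse response. Spatial
summability at each time makes the convolution and the spatial transform meaningful. -/
@[ext]
structure Controller where
  ker : ℤ → ℕ → ℝ
  summable : ∀ t, Summable fun k => ker k t

/-- The places where a disturbance enters the loop: the two state equations (`w^{x}`), the
control input (`w^u`) and the measurement (`w^y`). -/
inductive Dist
  | x1 | x2 | u | y
  deriving DecidableEq

/-- The signals of the loop. -/
inductive Signal
  | x1 | x2 | u | y

/-- The state `(x¹ₖ, x²ₖ)` at time `t` of the closed loop, started at rest, with disturbances `w`: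
* `x¹ₖ(t+1) = β x¹ₖ(t) + x²ₖ(t) + w^{x,1}ₖ(t)`,
* `x²ₖ(t+1) = α (x²ₖ(t) + κ (x²ₖ₋₁(t) + x²ₖ₊₁(t))) + w^{x,2}ₖ(t) + w^uₖ(t) + uₖ(t)`,
* `yₖ(t) = x¹ₖ(t) + w^yₖ(t)`,
* `uₖ(t) = ∑_{τ ≤ t} ∑ⱼ K_{k-j}(t-τ) yⱼ(τ)`. -/
def state (α β κ : ℝ) (K : Controller) (w : Dist → ℤ → ℕ → ℝ) : ℕ → ℤ → ℝ × ℝ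
  | 0 => fun _ => (0, 0)
  | t + 1 => fun k =>
      (β * (state α β κ K w t k).1 + (state α β κ K w t k).2 + w .x1 k t,
       α * ((state α β κ K w t k).2
          + κ * ((state α β κ K w t (k - 1)).2 + (state α β κ K w t (k + 1)).2))
        + w .x2 k t + w .u k t
        + ∑ τ : Fin (t + 1), ∑' j : ℤ,
            K.ker (k - j) (t - τ) * ((state α β κ K w τ j).1 + w .y j τ))
  termination_by t => t
  decreasing_by all_goals omega

/-- The measurement `y` in the closed loop. -/
def measurement (α β κ : ℝ) (K : Controller) (w : Dist → ℤ → ℕ → ℝ) (k : ℤ) (t : ℕ) : ℝ :=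
  (state α β κ K w t k).1 + w .y k t

/-- The control `u = K y` in the closed loop. -/
def control (α β κ : ℝ) (K : Controller) (w : Dist → ℤ → ℕ → ℝ) (k : ℤ) (t : ℕ) : ℝ :=
  ∑ τ : Fin (t + 1), ∑' j : ℤ, K.ker (k - j) (t - τ) * measurement α β κ K w j τ

theorem state_zero (α β κ : ℝ) (K : Controller) (w : Dist → ℤ → ℕ → ℝ) (k : ℤ) :
    state α β κ K w 0 k = (0, 0) := by
  rw [state]

theorem state_succ (α β κ : ℝ) (K : Controller) (w : Dist → ℤ → ℕ → ℝ) (k : ℤ) (t : ℕ) :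
    state α β κ K w (t + 1) k =
      (β * (state α β κ K w t k).1 + (state α β κ K w t k).2 + w .x1 k t,
       α * ((state α β κ K w t k).2
          + κ * ((state α β κ K w t (k - 1)).2 + (state α β κ K w t (k + 1)).2))
        + w .x2 k t + w .u k t + control α β κ K w k t) := by
  rw [state]
  rfl

/-- The unit impulse at site `0` and time `0` in channel `c`. -/
def impulse (c : Dist) : Dist → ℤ → ℕ → ℝ :=
  fun c' k t => if c' = c ∧ k = 0 ∧ t = 0 then 1 else 0

/-- The impulse response of the closed-loop map from the disturbance channel `c` to a signal. -/
def response (α β κ : ℝ) (K : Controller) (c : Dist) : Signal → ℤ → ℕ → ℝ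
  | .x1 => fun k t => (state α β κ K (impulse c) t k).1
  | .x2 => fun k t => (state α β κ K (impulse c) t k).2
  | .u => control α β κ K (impulse c)
  | .y => measurement α β κ K (impulse c)

/-- The closed-loop map `R` from `w^x` to `x`. -/
def slR (α β κ : ℝ) (K : Controller) (k : ℤ) (t : ℕ) : Matrix (Fin 2) (Fin 2) ℝ :=
  !![response α β κ K .x1 .x1 k t, response α β κ K .x2 .x1 k t;
     response α β κ K .x1 .x2 k t, response α β κ K .x2 .x2 k t]

/-- The closed-loop map `M` from `w^x` to `u`. -/
def slM (α β κ : ℝ) (K : Controller) (k : ℤ) (t : ℕ) : Matrix (Fin 1) (Fin 2) ℝ :=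
  !![response α β κ K .x1 .u k t, response α β κ K .x2 .u k t]

/-- The closed-loop map `N` from `w^y` to `x`. -/
def slN (α β κ : ℝ) (K : Controller) (k : ℤ) (t : ℕ) : Matrix (Fin 2) (Fin 1) ℝ :=
  !![response α β κ K .y .x1 k t; response α β κ K .y .x2 k t]

/-- The closed-loop map `L` from `w^y` to `u`. -/
def slL (α β κ : ℝ) (K : Controller) (k : ℤ) (t : ℕ) : Matrix (Fin 1) (Fin 1) ℝ :=
  !![response α β κ K .y .u k t]

/-- The closed-loop map `F(P, K)` from `w = (w^y, w^u)` to the regulated output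
`ζ = (x¹, x², u)`. -/
def closedLoop (α β κ : ℝ) (K : Controller) (k : ℤ) (t : ℕ) : Matrix (Fin 3) (Fin 2) ℝ :=
  !![response α β κ K .y .x1 k t, response α β κ K .u .x1 k t;
     response α β κ K .y .x2 k t, response α β κ K .u .x2 k t;
     response α β κ K .y .u k t, response α β κ K .u .u k t]

/-- Internal stability: every map from a disturbance entering the loop to a signal of the loop
is in `RH∞`. -/
def InternallyStabilizing (α β κ : ℝ) (K : Controller) : Prop :=
  ∀ (c : Dist) (s : Signal), IsRHinf (response α β κ K c s)

/-- The feasible controllers of the constrained problem: internally stabilizing, and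
`R`, `M`, `N`, `L` all have finite extent. -/
def SLFeasible (α β κ : ℝ) (K : Controller) : Prop :=
  InternallyStabilizing α β κ K ∧
    FiniteExtent (slR α β κ K) ∧ FiniteExtent (slM α β κ K) ∧
    FiniteExtent (slN α β κ K) ∧ FiniteExtent (slL α β κ K)

/-- Quantitative extent bounds on the four maps: `a` for `R`, `N` and `b` for `M`, `L`. -/
def SLExtentBounds (α β κ : ℝ) (a b : ℕ) (K : Controller) : Prop :=
  HasExtent a (slR α β κ K) ∧ HasExtent a (slN α β κ K) ∧
    HasExtent b (slM α β κ K) ∧ HasExtent b (slL α β κ K)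

/-! ### The model-matching problem -/

/-- The spatial indices `-E, …, E`. -/
abbrev Site (E : ℕ) : Type := {k : ℤ // k ∈ Finset.Icc (-(E : ℤ)) (E : ℤ)}

theorem card_site (E : ℕ) : Fintype.card (Site E) = 2 * E + 1 := by
  rw [Fintype.card_coe, Int.card_Icc]
  omega

/-- The sequence with value `a` at `0`, `b` at `±1`, `c` at `±2` and zero elsewhere. -/
def band (a b c : LaurentSeries ℝ) (k : ℤ) : LaurentSeries ℝ :=
  if k = 0 then a else if |k| = 1 then b else if |k| = 2 then c else 0

/-- A real constant as a transfer function. -/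
abbrev const (a : ℝ) : LaurentSeries ℝ := HahnSeries.C a

/-- The six scalar maps that appear in the cost. -/
inductive CostMap
  | n1 | r12 | n2 | r22 | l | m2
  deriving DecidableEq

instance : Fintype CostMap where
  elems := {.n1, .r12, .n2, .r22, .l, .m2}
  complete q := by cases q <;> decide

/-- The map `q` has sites `-(E + q.offset), …, E + q.offset`. -/
def CostMap.offset : CostMap → ℕ
  | .n1 => 2
  | .r12 => 1
  | .n2 => 2
  | .r22 => 1
  | .l => 3
  | .m2 => 2

/-- The entry of the Toeplitz matrix `V^q` on the diagonal `d` (row minus column). -/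
def Vdiag (α β κ : ℝ) : CostMap → ℤ → LaurentSeries ℝ
  | .n1 => fun d => (zVar ℝ - const β) * band (zVar ℝ - const α) (-const (α * κ)) 0 d
  | .r12 => fun d => band 1 0 0 d
  | .n2 => fun d => (zVar ℝ - const β) ^ 2 * band (zVar ℝ - const α) (-const (α * κ)) 0 d
  | .r22 => fun d => (zVar ℝ - const β) * band 1 0 0 d
  | .l => fun d => (zVar ℝ - const β) ^ 2 *
      band ((zVar ℝ - const α) ^ 2 + 2 * const (α * κ) ^ 2)
        (-(2 * const (α * κ) * (zVar ℝ - const α))) (const (α * κ) ^ 2) d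
  | .m2 => fun d => (zVar ℝ - const β) * band (zVar ℝ - const α) (-const (α * κ)) 0 d

/-- The entry of the vector `h^q` at the site `k`. -/
def hEntry (α β κ : ℝ) : CostMap → ℤ → LaurentSeries ℝ
  | .n1 => fun k => band (-1) 0 0 k
  | .r12 => fun _ => 0
  | .n2 => fun k => (zVar ℝ - const β) * band (-1) 0 0 k
  | .r22 => fun _ => 0
  | .l => fun k => (zVar ℝ - const β) * band (const α - zVar ℝ) (const (α * κ)) 0 k
  | .m2 => fun k => band (-1) 0 0 k

/-- The row indices of the stacked cost vector: the six blocks, each with its own sites. -/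
abbrev Row (E : ℕ) : Type := Σ q : CostMap, Site (E + q.offset)

/-- The stack of the six matrices `V^q`. -/
def Vstack (α β κ : ℝ) (E : ℕ) : Matrix (Row E) (Site (E + 1)) (LaurentSeries ℝ) :=
  Matrix.of fun r j => Vdiag α β κ r.1 (r.2.1 - j.1)

/-- The stack of the six vectors `h^q`. -/
def hstack (α β κ : ℝ) (E : ℕ) : Row E → LaurentSeries ℝ :=
  fun r => hEntry α β κ r.1 r.2.1

/-- `S = z⁻⁴ [0; I; 0]`. -/
def Smat (E : ℕ) : Matrix (Site (E + 1)) (Site E) (LaurentSeries ℝ) :=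
  Matrix.of fun i j => if i.1 = j.1 then (zVar ℝ)⁻¹ ^ 4 else 0

/-- The inverse spatial transform of `z⁻² + z⁻³ (σ + β)`, where `σ = α (1 + 2 κ cos θ)`. -/
def gEntry (α β κ : ℝ) (k : ℤ) : LaurentSeries ℝ :=
  (zVar ℝ)⁻¹ ^ 3 * band (zVar ℝ + const α + const β) (const (α * κ)) 0 k

/-- The vector `g`. -/
def gvec (α β κ : ℝ) (E : ℕ) : Site (E + 1) → LaurentSeries ℝ :=
  fun k => gEntry α β κ k.1

/-- The matrix `V^SL`, of size `(12 E + 28) × (2 E + 1)`. -/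
def VSL (α β κ : ℝ) (E : ℕ) : Matrix (Row E) (Site E) (LaurentSeries ℝ) :=
  Vstack α β κ E * Smat E

/-- The vector `h^SL`. -/
def hSL (α β κ : ℝ) (E : ℕ) : Row E → LaurentSeries ℝ :=
  (Vstack α β κ E).mulVec (gvec α β κ E) + hstack α β κ E

/-- The decision space `RH∞^{(2E+1) × 1}` of the model-matching problem. -/
def decisionSpace (E : ℕ) : Set (Site E → LaurentSeries ℝ) :=
  {f | ∀ k, f k ∈ RHinf ℝ}

/-- The cost `‖V^SL f + h^SL‖₂²`. -/
def modelCost (α β κ : ℝ) (E : ℕ) (f : Site E → LaurentSeries ℝ) : ℝ≥0∞ :=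
  columnNormSq ((VSL α β κ E).mulVec f + hSL α β κ E)

/-- The parameter `f` of a controller at the site `k`, defined by
`r¹² = z⁻² + z⁻³ (σ + β) + z⁻⁴ f`. -/
def parameter (α β κ : ℝ) (K : Controller) (k : ℤ) : LaurentSeries ℝ :=
  zVar ℝ ^ 4 * (zTransform (fun t => slR α β κ K k t 0 1) - gEntry α β κ k)

/-- Feasible controllers whose parameter `f` has extent `E`. -/
def SLFeasibleAt (α β κ : ℝ) (E : ℕ) (K : Controller) : Prop :=
  SLFeasible α β κ K ∧ HasExtent E (parameter α β κ K)

end SpatialSL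

end

open scoped ENNReal

noncomputable section

namespace SpatialSL

/-! ### Causal, stable and rational transfer functions -/

section Temporal

variable {𝕜 : Type*} [Field 𝕜]

theorem zVar_ne_zero : zVar 𝕜 ≠ 0 := by
  simp [zVar]

theorem algebraMap_laurent (c : 𝕜) :
    algebraMap 𝕜 (LaurentSeries 𝕜) c = HahnSeries.C c := by
  rw [HahnSeries.algebraMap_apply', PowerSeries.algebraMap_apply, Algebra.algebraMap_self_apply,
    HahnSeries.ofPowerSeries_C]

theorem coeff_C_mul (c : 𝕜) (G : LaurentSeries 𝕜) (t : ℤ) :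
    (HahnSeries.C c * G).coeff t = c * G.coeff t := by
  simp

theorem coeff_zVar_mul (G : LaurentSeries 𝕜) (t : ℤ) :
    (zVar 𝕜 * G).coeff t = G.coeff (t + 1) := by
  have h := HahnSeries.coeff_single_mul_add (r := (1 : 𝕜)) (x := G) (a := t + 1) (b := (-1 : ℤ))
  rw [add_neg_cancel_right, one_mul] at h
  exact h

theorem coeff_zVar_pow_mul (n : ℕ) (G : LaurentSeries 𝕜) (t : ℤ) :
    (zVar 𝕜 ^ n * G).coeff t = G.coeff (t + n) := by
  induction n generalizing t with
  | zero => simp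
  | succ n ih =>
    rw [pow_succ', mul_assoc, coeff_zVar_mul, ih]
    congr 1
    push_cast
    ring

theorem aeval_zVar_monomial (n : ℕ) (a : 𝕜) :
    Polynomial.aeval (zVar 𝕜) (Polynomial.monomial n a) = HahnSeries.C a * zVar 𝕜 ^ n := by
  rw [Polynomial.aeval_monomial, algebraMap_laurent]

theorem coeff_aeval_zVar (N : Polynomial 𝕜) (t : ℤ) :
    (Polynomial.aeval (zVar 𝕜) N).coeff t = if t ≤ 0 then N.coeff (-t).toNat else 0 := by
  induction N using Polynomial.induction_on' with
  | add p q hp hq =>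
    rw [map_add, HahnSeries.coeff_add, hp, hq, Polynomial.coeff_add]
    split_ifs <;> simp
  | monomial n a =>
    rw [aeval_zVar_monomial, coeff_C_mul, ← mul_one (zVar 𝕜 ^ n), coeff_zVar_pow_mul,
      HahnSeries.coeff_one, Polynomial.coeff_monomial]
    by_cases h : t + n = 0
    · have h1 : t ≤ 0 := by omega
      have h2 : n = (-t).toNat := by omega
      simp [h, h1, ← h2]
    · by_cases h1 : t ≤ 0
      · have h2 : n ≠ (-t).toNat := by omega
        simp [h, h1, h2]
      · simp [h, h1]

theorem coeff_aeval_zVar_neg (N : Polynomial 𝕜) (n : ℕ) :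
    (Polynomial.aeval (zVar 𝕜) N).coeff (-(n : ℤ)) = N.coeff n := by
  rw [coeff_aeval_zVar]
  simp

theorem aeval_zVar_injective :
    Function.Injective (Polynomial.aeval (R := 𝕜) (zVar 𝕜)) := by
  intro p q h
  ext n
  rw [← coeff_aeval_zVar_neg, h, coeff_aeval_zVar_neg]

theorem coeff_aeval_zVar_mul (D : Polynomial 𝕜) {n : ℕ} (hn : D.natDegree < n)
    (G : LaurentSeries 𝕜) (t : ℤ) :
    (Polynomial.aeval (zVar 𝕜) D * G).coeff t
      = ∑ i ∈ Finset.range n, D.coeff i * G.coeff (t + i) := by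
  conv_lhs => rw [D.as_sum_range' n hn]
  rw [map_sum, Finset.sum_mul, HahnSeries.coeff_sum]
  refine Finset.sum_congr rfl fun i _ => ?_
  rw [aeval_zVar_monomial, mul_assoc, coeff_C_mul, coeff_zVar_pow_mul]

theorem order_aeval_zVar {N : Polynomial 𝕜} (hN : N ≠ 0) :
    (Polynomial.aeval (zVar 𝕜) N).order = -(N.natDegree : ℤ) := by
  have h0 : Polynomial.aeval (zVar 𝕜) N ≠ 0 := by
    intro h
    exact hN (aeval_zVar_injective (h.trans (map_zero _).symm))
  apply le_antisymm
  · apply HahnSeries.order_le_of_coeff_ne_zero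
    rw [coeff_aeval_zVar_neg]
    simpa using hN
  · by_contra! hlt
    refine h0 (HahnSeries.leadingCoeff_eq_zero.mp ?_)
    rw [HahnSeries.leadingCoeff_eq, coeff_aeval_zVar]
    have : (Polynomial.aeval (zVar 𝕜) N).order ≤ 0 := by omega
    rw [if_pos this]
    apply Polynomial.coeff_eq_zero_of_natDegree_lt
    omega

/-- Causal transfer functions: the impulse response vanishes at negative times. -/
def IsCausal (G : LaurentSeries 𝕜) : Prop := ∀ t : ℤ, t < 0 → G.coeff t = 0

theorem coeff_zTransform (g : ℕ → 𝕜) (t : ℕ) : (zTransform g).coeff (t : ℤ) = g t := by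
  unfold zTransform
  rw [LaurentSeries.coeff_coe_powerSeries, PowerSeries.coeff_mk]

theorem isCausal_zTransform (g : ℕ → 𝕜) : IsCausal (zTransform g) := by
  intro t ht
  unfold zTransform
  rw [PowerSeries.coeff_coe, if_pos ht]

theorem zTransform_injective : Function.Injective (zTransform (𝕜 := 𝕜)) := by
  intro g h hgh
  ext t
  rw [← coeff_zTransform g t, hgh, coeff_zTransform]

theorem IsCausal.eq_zTransform {G : LaurentSeries 𝕜} (hG : IsCausal G) :
    G = zTransform fun t => G.coeff t := by
  ext t
  rcases lt_or_ge t 0 with ht | ht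
  · rw [hG t ht, isCausal_zTransform _ t ht]
  · lift t to ℕ using ht
    rw [coeff_zTransform]

theorem IsCausal.ext {G H : LaurentSeries 𝕜} (hG : IsCausal G) (hH : IsCausal H)
    (h : ∀ t : ℕ, G.coeff t = H.coeff t) : G = H := by
  rw [hG.eq_zTransform, hH.eq_zTransform]
  simp only [h]

theorem zTransform_add (g h : ℕ → 𝕜) :
    zTransform (fun t => g t + h t) = zTransform g + zTransform h := by
  unfold zTransform
  rw [← map_add]
  rfl

theorem zTransform_zero : zTransform (0 : ℕ → 𝕜) = 0 := by
  unfold zTransform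
  rw [← map_zero (HahnSeries.ofPowerSeries ℤ 𝕜)]
  rfl

theorem zTransform_const_mul (c : 𝕜) (g : ℕ → 𝕜) :
    zTransform (fun t => c * g t) = HahnSeries.C c * zTransform g := by
  unfold zTransform
  rw [← HahnSeries.ofPowerSeries_C, ← map_mul]
  congr 1
  ext t
  simp

theorem zTransform_sub (g h : ℕ → 𝕜) :
    zTransform (fun t => g t - h t) = zTransform g - zTransform h := by
  unfold zTransform
  rw [← map_sub]
  rfl

theorem zTransform_sum {ι : Type*} (s : Finset ι) (g : ι → ℕ → 𝕜) :
    zTransform (fun t => ∑ i ∈ s, g i t) = ∑ i ∈ s, zTransform (g i) := by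
  unfold zTransform
  rw [← map_sum]
  congr 1
  ext t
  simp

theorem zTransform_succ (g : ℕ → 𝕜) :
    zTransform (fun t => g (t + 1)) = zVar 𝕜 * (zTransform g - HahnSeries.C (g 0)) := by
  refine IsCausal.ext (isCausal_zTransform _) ?_ fun t => ?_
  · intro t ht
    rw [coeff_zVar_mul, HahnSeries.coeff_sub]
    rcases eq_or_ne t (-1) with rfl | h
    · have := coeff_zTransform g 0
      simp_all
    · rw [isCausal_zTransform _ _ (by omega)]
      rw [HahnSeries.C_apply, HahnSeries.coeff_single_of_ne (by omega), sub_zero]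
  · rw [coeff_zTransform, coeff_zVar_mul, HahnSeries.coeff_sub]
    have h : (t : ℤ) + 1 ≠ 0 := by omega
    rw [HahnSeries.C_apply, HahnSeries.coeff_single_of_ne h, sub_zero]
    exact_mod_cast (coeff_zTransform g (t + 1)).symm

theorem zTransform_eq_add_inv (g : ℕ → 𝕜) :
    zTransform g = HahnSeries.C (g 0) + (zVar 𝕜)⁻¹ * zTransform (fun t => g (t + 1)) := by
  rw [zTransform_succ, inv_mul_cancel_left₀ zVar_ne_zero]
  ring

variable [Algebra 𝕜 ℂ]

/-- Stable rational transfer functions, not necessarily causal. -/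
def stableRational (𝕜 : Type*) [Field 𝕜] [Algebra 𝕜 ℂ] : Subalgebra 𝕜 (LaurentSeries 𝕜) where
  carrier := {G | ∃ N D : Polynomial 𝕜, (∀ s : ℂ, Polynomial.aeval s D = 0 → ‖s‖ < 1) ∧
      Polynomial.aeval (zVar 𝕜) D * G = Polynomial.aeval (zVar 𝕜) N}
  mul_mem' := by
    rintro G H ⟨N, D, hD, hG⟩ ⟨N', D', hD', hH⟩
    refine ⟨N * N', D * D', fun s hs => ?_, ?_⟩
    · rw [map_mul, mul_eq_zero] at hs
      exact hs.elim (hD s) (hD' s)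
    · rw [map_mul, map_mul, ← hG, ← hH]
      ring
  add_mem' := by
    rintro G H ⟨N, D, hD, hG⟩ ⟨N', D', hD', hH⟩
    refine ⟨N * D' + N' * D, D * D', fun s hs => ?_, ?_⟩
    · rw [map_mul, mul_eq_zero] at hs
      exact hs.elim (hD s) (hD' s)
    · rw [map_add, map_mul, map_mul, map_mul, ← hG, ← hH]
      ring
  algebraMap_mem' c := ⟨Polynomial.C c, 1, by simp, by simp⟩

theorem C_mem_stableRational (c : 𝕜) : HahnSeries.C c ∈ stableRational 𝕜 := by
  rw [← algebraMap_laurent]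
  exact (stableRational 𝕜).algebraMap_mem c

theorem zVar_mem_stableRational : zVar 𝕜 ∈ stableRational 𝕜 :=
  ⟨Polynomial.X, 1, by simp, by simp⟩

theorem inv_zVar_mem_stableRational : (zVar 𝕜)⁻¹ ∈ stableRational 𝕜 :=
  ⟨1, Polynomial.X, by simp +contextual, by simp [zVar_ne_zero]⟩

theorem denominator_ne_zero {D : Polynomial 𝕜}
    (hD : ∀ s : ℂ, Polynomial.aeval s D = 0 → ‖s‖ < 1) : D ≠ 0 := by
  rintro rfl
  simpa using hD 1 (by simp)

/-- For stable rational transfer functions, properness is causality. -/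
theorem mem_RHinf_iff {G : LaurentSeries 𝕜} :
    G ∈ RHinf 𝕜 ↔ IsCausal G ∧ G ∈ stableRational 𝕜 := by
  constructor
  · rintro ⟨N, D, hdeg, hD, hG⟩
    refine ⟨?_, N, D, hD, hG⟩
    have hD0 := denominator_ne_zero hD
    have hDz : Polynomial.aeval (zVar 𝕜) D ≠ 0 := by
      intro h
      exact hD0 (aeval_zVar_injective (h.trans (map_zero _).symm))
    rcases eq_or_ne G 0 with rfl | hG0
    · intro t _
      simp
    have hN0 : N ≠ 0 := by
      rintro rfl
      rw [map_zero] at hG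
      exact (mul_ne_zero hDz hG0) hG
    have ho := HahnSeries.order_mul hDz hG0
    rw [hG, order_aeval_zVar hN0, order_aeval_zVar hD0] at ho
    have := Polynomial.natDegree_le_natDegree hdeg
    intro t ht
    exact HahnSeries.coeff_eq_zero_of_lt_order (by omega)
  · rintro ⟨hc, N, D, hD, hG⟩
    refine ⟨N, D, ?_, hD, hG⟩
    rw [Polynomial.degree_le_iff_coeff_zero]
    intro n hn
    rw [← coeff_aeval_zVar_neg, ← hG, coeff_aeval_zVar_mul D (Nat.lt_succ_self _)]
    refine Finset.sum_eq_zero fun i hi => ?_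
    have h1 : D.natDegree < n :=
      (Polynomial.natDegree_lt_iff_degree_lt (denominator_ne_zero hD)).mpr hn
    rw [Finset.mem_range] at hi
    rw [hc _ (by omega), mul_zero]

theorem zTransform_mem_RHinf_iff {g : ℕ → 𝕜} :
    zTransform g ∈ RHinf 𝕜 ↔ zTransform g ∈ stableRational 𝕜 := by
  rw [mem_RHinf_iff, and_iff_right (isCausal_zTransform g)]

end Temporal

/-! ### Real and complex coefficients -/

theorem mem_stableRational_complex_of_real {G : LaurentSeries ℝ} {H : LaurentSeries ℂ}
    (hGH : ∀ t, H.coeff t = G.coeff t) (hG : G ∈ stableRational ℝ) : H ∈ stableRational ℂ := by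
  obtain ⟨N, D, hD, h⟩ := hG
  refine ⟨N.map (algebraMap ℝ ℂ), D.map (algebraMap ℝ ℂ), fun s hs => hD s ?_, ?_⟩
  · rwa [Polynomial.aeval_map_algebraMap] at hs
  · ext t
    have ht := congrArg (fun F : LaurentSeries ℝ => ((F.coeff t : ℝ) : ℂ)) h
    beta_reduce at ht
    rw [coeff_aeval_zVar_mul D (Nat.lt_succ_self _), coeff_aeval_zVar] at ht
    rw [coeff_aeval_zVar_mul _ ((Polynomial.natDegree_map_le).trans_lt
      (Nat.lt_succ_self D.natDegree)), coeff_aeval_zVar]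
    simp only [Polynomial.coeff_map, hGH, Complex.coe_algebraMap]
    push_cast at ht
    rw [ht]
    split_ifs <;> simp

theorem mem_stableRational_real_of_complex {G : LaurentSeries ℝ} {H : LaurentSeries ℂ}
    (hGH : ∀ t, H.coeff t = G.coeff t) (hH : H ∈ stableRational ℂ) : G ∈ stableRational ℝ := by
  obtain ⟨N, D, hD, h⟩ := hH
  set D' := D.map (starRingEnd ℂ) with hD'
  have hP : D * D' ∈ Polynomial.lifts Complex.ofRealHom := by
    rw [Polynomial.lifts_iff_coeff_lifts]
    intro n
    have hconj : (D * D').map (starRingEnd ℂ) = D * D' := by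
      rw [Polynomial.map_mul, hD', Polynomial.map_map]
      have : (starRingEnd ℂ).comp (starRingEnd ℂ) = RingHom.id ℂ := by
        ext x
        simp
      rw [this, Polynomial.map_id, mul_comm]
    have hn := congrArg (fun p => Polynomial.coeff p n) hconj
    simp only [Polynomial.coeff_map] at hn
    obtain ⟨r, hr⟩ := Complex.conj_eq_iff_real.mp hn
    exact ⟨r, hr.symm⟩
  obtain ⟨P, hP⟩ := (Polynomial.mem_lifts _).mp hP
  have hPH : Polynomial.aeval (zVar ℂ) (D * D') * H = Polynomial.aeval (zVar ℂ) (N * D') := by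
    rw [map_mul, map_mul, ← h]
    ring
  have hcoeff : ∀ t, (Polynomial.aeval (zVar ℂ) (N * D')).coeff t
      = ((Polynomial.aeval (zVar ℝ) P * G).coeff t : ℝ) := by
    intro t
    rw [← hPH, ← hP, coeff_aeval_zVar_mul P (Nat.lt_succ_self _),
      coeff_aeval_zVar_mul _ ((Polynomial.natDegree_map_le).trans_lt
      (Nat.lt_succ_self P.natDegree))]
    push_cast
    refine Finset.sum_congr rfl fun i _ => ?_
    rw [hGH, Polynomial.coeff_map]
    rfl
  have hN : N * D' ∈ Polynomial.lifts Complex.ofRealHom := by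
    rw [Polynomial.lifts_iff_coeff_lifts]
    intro n
    rw [← coeff_aeval_zVar_neg, hcoeff]
    exact ⟨_, rfl⟩
  obtain ⟨N₀, hN₀⟩ := (Polynomial.mem_lifts _).mp hN
  refine ⟨N₀, P, fun s hs => ?_, ?_⟩
  · have h1 : Polynomial.aeval s (D * D') = 0 := by
      rw [← hP]
      exact (Polynomial.aeval_map_algebraMap ℂ s P).trans hs
    rw [map_mul, mul_eq_zero] at h1
    rcases h1 with h1 | h1
    · exact hD s h1
    · have h2 : Polynomial.aeval (starRingEnd ℂ s) D = 0 := by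
        have h3 : Polynomial.eval s D' = 0 := by simpa using h1
        have h4 := Polynomial.eval_map_apply (f := starRingEnd ℂ) (p := D) (starRingEnd ℂ s)
        rw [Complex.conj_conj, ← hD', h3] at h4
        simpa using h4.symm
      simpa using hD _ h2
  · ext t
    have ht := hcoeff t
    rw [coeff_aeval_zVar, ← hN₀] at ht
    rw [coeff_aeval_zVar]
    apply Complex.ofReal_injective
    rw [← ht]
    split_ifs <;> simp

/-! ### Summability of the impulse response -/

theorem summable_norm_coeff_of_sub {G : LaurentSeries ℂ} {p : ℂ} (hp : ‖p‖ < 1)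
    (h : Summable fun t => ‖((zVar ℂ - HahnSeries.C p) * G).coeff t‖) :
    Summable fun t => ‖G.coeff t‖ := by
  obtain ⟨m, hm⟩ : ∃ m : ℤ, ∀ t < m, G.coeff t = 0 :=
    ⟨G.order, fun t ht => HahnSeries.coeff_eq_zero_of_lt_order ht⟩
  set b : ℤ → ℝ := fun t => ‖((zVar ℂ - HahnSeries.C p) * G).coeff t‖ with hb
  have hstep : ∀ t, ‖G.coeff (t + 1)‖ ≤ ‖p‖ * ‖G.coeff t‖ + b t := by
    intro t
    have : G.coeff (t + 1) = p * G.coeff t + ((zVar ℂ - HahnSeries.C p) * G).coeff t := by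
      rw [sub_mul, HahnSeries.coeff_sub, coeff_zVar_mul, coeff_C_mul]
      ring
    rw [this]
    refine (norm_add_le _ _).trans ?_
    rw [norm_mul]
  have hbound : ∀ n : ℕ, ∑ i ∈ Finset.range n, ‖G.coeff (m + i)‖ ≤ (∑' t, b t) / (1 - ‖p‖) := by
    intro n
    rw [le_div_iff₀ (by linarith)]
    have h1 : ∑ i ∈ Finset.range n, ‖G.coeff (m + i)‖
        ≤ ∑ i ∈ Finset.range n, (‖p‖ * ‖G.coeff (m - 1 + i)‖ + b (m - 1 + i)) := by
      refine Finset.sum_le_sum fun i _ => ?_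
      have := hstep (m - 1 + i)
      rwa [show m - 1 + (i : ℤ) + 1 = m + i by ring] at this
    have h2 : ∑ i ∈ Finset.range n, ‖G.coeff (m - 1 + i)‖
        ≤ ∑ i ∈ Finset.range n, ‖G.coeff (m + i)‖ := by
      have h3 : ∑ i ∈ Finset.range (n + 1), ‖G.coeff (m - 1 + i)‖
          = ∑ i ∈ Finset.range n, ‖G.coeff (m + i)‖ := by
        rw [Finset.sum_range_succ', hm (m - 1 + ((0 : ℕ) : ℤ)) (by simp), norm_zero, add_zero]
        refine Finset.sum_congr rfl fun i _ => ?_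
        congr 2
        push_cast
        ring
      rw [← h3, Finset.sum_range_succ]
      exact le_add_of_nonneg_right (norm_nonneg _)
    have h4 : ∑ i ∈ Finset.range n, b (m - 1 + i) ≤ ∑' t, b t := by
      have hinj : Function.Injective fun i : ℕ => m - 1 + (i : ℤ) := by
        intro i j hij
        simpa using hij
      have := (h.sum_le_tsum ((Finset.range n).image fun i : ℕ => m - 1 + (i : ℤ))
        fun _ _ => norm_nonneg _)
      rwa [Finset.sum_image hinj.injOn] at this
    rw [Finset.sum_add_distrib, ← Finset.mul_sum] at h1
    nlinarith [mul_le_mul_of_nonneg_left h2 (norm_nonneg p)]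
  have hnat : Summable fun i : ℕ => ‖G.coeff (m + i)‖ :=
    summable_of_sum_range_le (fun _ => norm_nonneg _) hbound
  have hinj : Function.Injective fun i : ℕ => m + (i : ℤ) := by
    intro i j hij
    simpa using hij
  refine (hinj.summable_iff ?_).mp hnat
  intro t ht
  rw [hm t, norm_zero]
  by_contra! hlt
  exact ht ⟨(t - m).toNat, by simp; omega⟩

theorem summable_norm_coeff_aeval (N : Polynomial ℂ) :
    Summable fun t => ‖(Polynomial.aeval (zVar ℂ) N).coeff t‖ := by
  refine summable_of_ne_finset_zero (s := Finset.Icc (-(N.natDegree : ℤ)) 0) fun t ht => ?_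
  rw [coeff_aeval_zVar]
  split_ifs with h
  · rw [Polynomial.coeff_eq_zero_of_natDegree_lt, norm_zero]
    rw [Finset.mem_Icc] at ht
    omega
  · exact norm_zero

theorem summable_norm_coeff_of_prod (s : Multiset ℂ) (hs : ∀ p ∈ s, ‖p‖ < 1) {G : LaurentSeries ℂ}
    (h : Summable fun t =>
      ‖((s.map fun p => zVar ℂ - HahnSeries.C p).prod * G).coeff t‖) :
    Summable fun t => ‖G.coeff t‖ := by
  induction s using Multiset.induction_on generalizing G with
  | empty => simpa using h
  | cons p s ih =>
    refine ih (fun q hq => hs q (Multiset.mem_cons_of_mem hq)) ?_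
    refine summable_norm_coeff_of_sub (hs p (Multiset.mem_cons_self p s)) ?_
    rwa [Multiset.map_cons, Multiset.prod_cons, mul_assoc] at h

theorem summable_norm_coeff_complex {G : LaurentSeries ℂ} (hG : G ∈ stableRational ℂ) :
    Summable fun t => ‖G.coeff t‖ := by
  obtain ⟨N, D, hD, h⟩ := hG
  have hD0 := denominator_ne_zero hD
  refine summable_norm_coeff_of_prod D.roots (fun p hp => hD p ?_) ?_
  · simpa [hD0] using hp
  · have hfac : Polynomial.aeval (zVar ℂ) D
        = HahnSeries.C D.leadingCoeff * (D.roots.map fun p => zVar ℂ - HahnSeries.C p).prod := by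
      conv_lhs => rw [(IsAlgClosed.splits D).eq_prod_roots]
      rw [map_mul, Polynomial.aeval_C, algebraMap_laurent, map_multiset_prod, Multiset.map_map]
      congr 2
      refine Multiset.map_congr rfl fun p _ => ?_
      simp [algebraMap_laurent]
    rw [hfac, mul_assoc] at h
    have hN := summable_norm_coeff_aeval N
    rw [← h] at hN
    simp only [coeff_C_mul, norm_mul] at hN
    exact (summable_mul_left_iff (by simpa using hD0)).mp hN

theorem summable_abs_coeff {G : LaurentSeries ℝ} (hG : G ∈ stableRational ℝ) :
    Summable fun t => |G.coeff t| := by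
  have h := summable_norm_coeff_complex (mem_stableRational_complex_of_real
    (H := G.map Complex.ofRealHom) (fun t => by simp) hG)
  simpa using h

theorem summable_sq_coeff {G : LaurentSeries ℝ} (hG : G ∈ stableRational ℝ) :
    Summable fun t => G.coeff t ^ 2 := by
  have h := summable_abs_coeff hG
  refine Summable.of_norm_bounded_eventually h ?_
  filter_upwards [h.tendsto_cofinite_zero.eventually_le_const zero_lt_one] with t ht
  rw [norm_pow, Real.norm_eq_abs, sq]
  exact mul_le_of_le_one_left (abs_nonneg _) ht

/-! ### Spatial transforms of maps with finite extent -/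

theorem HasExtent.spatialTransform_eq {E : ℕ} {G : ℤ → ℕ → ℝ} (hG : HasExtent E G) (θ : ℝ)
    (t : ℕ) :
    spatialTransform G θ t
      = ∑ k ∈ Finset.Icc (-(E : ℤ)) E, (G k t : ℂ) * Complex.exp (-(Complex.I * k * θ)) := by
  unfold spatialTransform
  refine tsum_eq_sum fun k hk => ?_
  rw [hG k, Pi.zero_apply, Complex.ofReal_zero, zero_mul]
  rw [Finset.mem_Icc, ← abs_le] at hk
  exact not_le.mp hk

theorem sum_exp_frequencies {n : ℕ} (hn : 0 < n) {d : ℤ} (hd : |d| < n) :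
    ∑ j ∈ Finset.range n, Complex.exp (Complex.I * d * (2 * Real.pi * j / n : ℝ))
      = if d = 0 then (n : ℂ) else 0 := by
  split_ifs with h
  · simp [h]
  · have hn' : (n : ℂ) ≠ 0 := by exact_mod_cast hn.ne'
    have hπ : (2 * Real.pi * Complex.I : ℂ) ≠ 0 := Complex.two_pi_I_ne_zero
    set x : ℂ := Complex.exp (d / n * (2 * Real.pi * Complex.I)) with hx
    have hterm : ∀ j : ℕ, Complex.exp (Complex.I * d * (2 * Real.pi * j / n : ℝ)) = x ^ j := by
      intro j
      rw [hx, ← Complex.exp_nat_mul]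
      congr 1
      push_cast
      field_simp
    have hx1 : x ≠ 1 := by
      intro h1
      obtain ⟨m, hm⟩ := Complex.exp_eq_one_iff.mp h1
      have h2 : (d : ℂ) / n = m := mul_right_cancel₀ hπ hm
      rw [div_eq_iff hn'] at h2
      have h3 : d = m * n := by exact_mod_cast h2
      have hm0 : m ≠ 0 := by
        rintro rfl
        exact h (by simpa using h3)
      have h4 : (n : ℤ) ≤ |d| := by
        rw [h3, abs_mul, Nat.abs_cast]
        exact le_mul_of_one_le_left (by positivity) (Int.one_le_abs hm0)
      omega
    have hxn : x ^ n = 1 := by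
      rw [hx, ← Complex.exp_nat_mul, Complex.exp_eq_one_iff]
      exact ⟨d, by field_simp⟩
    simp only [hterm]
    rw [geom_sum_eq hx1, hxn, sub_self, zero_div]

/-- A map with finite extent is recovered from finitely many spatial frequencies. -/
theorem HasExtent.inverse_spatialTransform {E : ℕ} {G : ℤ → ℕ → ℝ} (hG : HasExtent E G) {m : ℤ}
    (hm : |m| ≤ E) (t : ℕ) :
    ∑ j ∈ Finset.range (2 * E + 1),
        Complex.exp (Complex.I * m * (2 * Real.pi * j / (2 * E + 1 : ℕ) : ℝ)) *
          spatialTransform G (2 * Real.pi * j / (2 * E + 1 : ℕ)) t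
      = ((2 * E + 1 : ℕ) : ℂ) * G m t := by
  simp only [hG.spatialTransform_eq, Finset.mul_sum]
  rw [Finset.sum_comm]
  have hk : ∀ k ∈ Finset.Icc (-(E : ℤ)) E,
      ∑ j ∈ Finset.range (2 * E + 1),
        Complex.exp (Complex.I * m * (2 * Real.pi * j / (2 * E + 1 : ℕ) : ℝ)) *
          ((G k t : ℂ) * Complex.exp (-(Complex.I * k * (2 * Real.pi * j / (2 * E + 1 : ℕ) : ℝ))))
        = if m = k then ((2 * E + 1 : ℕ) : ℂ) * G k t else 0 := by
    intro k hk
    rw [Finset.mem_Icc] at hk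
    have hd : |m - k| < ((2 * E + 1 : ℕ) : ℤ) := by
      rw [abs_le] at hm
      rw [abs_lt]
      push_cast
      omega
    have hsum := sum_exp_frequencies (Nat.succ_pos (2 * E)) hd
    have hterm : ∀ j : ℕ,
        Complex.exp (Complex.I * m * (2 * Real.pi * j / (2 * E + 1 : ℕ) : ℝ)) *
          ((G k t : ℂ) * Complex.exp (-(Complex.I * k * (2 * Real.pi * j / (2 * E + 1 : ℕ) : ℝ))))
        = (G k t : ℂ) *
          Complex.exp (Complex.I * (m - k : ℤ) * (2 * Real.pi * j / (2 * E + 1 : ℕ) : ℝ)) := by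
      intro j
      rw [mul_left_comm, ← Complex.exp_add]
      congr 2
      push_cast
      ring
    simp only [hterm]
    rw [← Finset.mul_sum]
    refine (congrArg _ hsum).trans ?_
    simp only [sub_eq_zero]
    split_ifs
    · ring
    · ring
  rw [Finset.sum_congr rfl hk, Finset.sum_ite_eq, if_pos]
  rwa [Finset.mem_Icc, ← abs_le]

/-- For maps with finite extent, `RH∞` can be checked site by site. -/
theorem HasExtent.isRHinf_iff {E : ℕ} {G : ℤ → ℕ → ℝ} (hG : HasExtent E G) :
    IsRHinf G ↔ ∀ k, zTransform (G k) ∈ stableRational ℝ := by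
  have hreal : ∀ k t, (zTransform fun t => (G k t : ℂ)).coeff t = (zTransform (G k)).coeff t := by
    intro k t
    rcases lt_or_ge t 0 with ht | ht
    · rw [isCausal_zTransform _ t ht, isCausal_zTransform _ t ht, Complex.ofReal_zero]
    · lift t to ℕ using ht
      rw [coeff_zTransform, coeff_zTransform]
  constructor
  · rintro ⟨-, h⟩ m
    rcases lt_or_ge (E : ℤ) |m| with hm | hm
    · rw [hG m hm, zTransform_zero]
      exact zero_mem _
    refine mem_stableRational_real_of_complex (hreal m) ?_
    have hn : ((2 * E + 1 : ℕ) : ℂ) ≠ 0 := Nat.cast_ne_zero.mpr (Nat.succ_ne_zero _)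
    have hseq : (fun t => (G m t : ℂ)) = fun t => ((2 * E + 1 : ℕ) : ℂ)⁻¹ *
        ∑ j ∈ Finset.range (2 * E + 1),
        Complex.exp (Complex.I * m * (2 * Real.pi * j / (2 * E + 1 : ℕ) : ℝ)) *
          spatialTransform G (2 * Real.pi * j / (2 * E + 1 : ℕ)) t := by
      ext t
      rw [hG.inverse_spatialTransform hm, inv_mul_cancel_left₀ hn]
    rw [hseq, zTransform_const_mul, zTransform_sum]
    refine mul_mem (C_mem_stableRational _) (sum_mem fun j _ => ?_)
    rw [zTransform_const_mul]
    exact mul_mem (C_mem_stableRational _) (zTransform_mem_RHinf_iff.mp (h _))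
  · intro h
    refine ⟨fun t => ?_, fun θ => zTransform_mem_RHinf_iff.mpr ?_⟩
    · refine summable_of_ne_finset_zero (s := Finset.Icc (-(E : ℤ)) E) fun k hk => ?_
      rw [Finset.mem_Icc, ← abs_le] at hk
      rw [hG k (not_le.mp hk), Pi.zero_apply]
    · have hseq : spatialTransform G θ = fun t => ∑ k ∈ Finset.Icc (-(E : ℤ)) E,
          Complex.exp (-(Complex.I * k * θ)) * (G k t : ℂ) := by
        ext t
        rw [hG.spatialTransform_eq]
        exact Finset.sum_congr rfl fun _ _ => mul_comm _ _
      rw [hseq, zTransform_sum]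
      refine sum_mem fun k _ => ?_
      rw [zTransform_const_mul]
      exact mul_mem (C_mem_stableRational _) (mem_stableRational_complex_of_real (hreal k) (h k))

/-! ### Extents and elementary operations on impulse responses -/

theorem HasExtent.mono {X : Type*} [Zero X] {E F : ℕ} {G : ℤ → X} (h : HasExtent E G)
    (hEF : E ≤ F) : HasExtent F G :=
  fun k hk => h k (lt_of_le_of_lt (by exact_mod_cast hEF) hk)

/-- The unit impulse at site `0` and time `0`. -/
def unitImpulse (k : ℤ) (t : ℕ) : ℝ := if k = 0 ∧ t = 0 then 1 else 0

/-- Multiplication by `z - β`, for responses that vanish at time `0`. -/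
def advance₁ (β : ℝ) (x : ℤ → ℕ → ℝ) (k : ℤ) (t : ℕ) : ℝ := x k (t + 1) - β * x k t

/-- Multiplication by `z - σ`, where `σ = α (1 + 2 κ cos θ)`, for responses that vanish at
time `0`. -/
def advance₂ (α κ : ℝ) (x : ℤ → ℕ → ℝ) (k : ℤ) (t : ℕ) : ℝ :=
  x k (t + 1) - α * (x k t + κ * (x (k - 1) t + x (k + 1) t))

theorem advance₂_advance₁ (α β κ : ℝ) (x : ℤ → ℕ → ℝ) :
    advance₂ α κ (advance₁ β x) = advance₁ β (advance₂ α κ x) := by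
  ext k t
  unfold advance₂ advance₁
  ring

theorem HasExtent.apply {E : ℕ} {x : ℤ → ℕ → ℝ} (h : HasExtent E x) {k : ℤ} (hk : (E : ℤ) < |k|)
    (t : ℕ) : x k t = 0 := by
  rw [h k hk, Pi.zero_apply]

theorem HasExtent.of_apply {E : ℕ} {x : ℤ → ℕ → ℝ} (h : ∀ k, (E : ℤ) < |k| → ∀ t, x k t = 0) :
    HasExtent E x :=
  fun k hk => funext fun t => h k hk t

theorem hasExtent_unitImpulse (E : ℕ) : HasExtent E unitImpulse := by
  refine HasExtent.of_apply fun k hk t => ?_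
  have : k ≠ 0 := by
    rintro rfl
    simp at hk
    omega
  simp [unitImpulse, this]

theorem HasExtent.advance₁ {E : ℕ} {x : ℤ → ℕ → ℝ} (h : HasExtent E x) (β : ℝ) :
    HasExtent E (advance₁ β x) := by
  refine HasExtent.of_apply fun k hk t => ?_
  simp [SpatialSL.advance₁, h.apply hk]

theorem HasExtent.advance₂ {E : ℕ} {x : ℤ → ℕ → ℝ} (h : HasExtent E x) (α κ : ℝ) :
    HasExtent (E + 1) (advance₂ α κ x) := by
  refine HasExtent.of_apply fun k hk t => ?_
  have h0 : (E : ℤ) < |k| := by push_cast at hk; omega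
  have h1 : (E : ℤ) < |k - 1| := by
    rw [lt_abs] at hk ⊢
    push_cast at hk
    omega
  have h2 : (E : ℤ) < |k + 1| := by
    rw [lt_abs] at hk ⊢
    push_cast at hk
    omega
  simp [SpatialSL.advance₂, h.apply h0, h.apply h1, h.apply h2]

theorem HasExtent.sub {E : ℕ} {x y : ℤ → ℕ → ℝ} (hx : HasExtent E x) (hy : HasExtent E y) :
    HasExtent E (x - y) := fun k hk => by
  rw [Pi.sub_apply, hx k hk, hy k hk, sub_zero]

theorem HasExtent.add {E : ℕ} {x y : ℤ → ℕ → ℝ} (hx : HasExtent E x) (hy : HasExtent E y) :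
    HasExtent E (x + y) := fun k hk => by
  rw [Pi.add_apply, hx k hk, hy k hk, add_zero]

/-! ### Stability site by site -/

theorem zTransform_unitImpulse (k : ℤ) :
    zTransform (unitImpulse k) = HahnSeries.C (if k = 0 then 1 else 0) := by
  rw [zTransform_eq_add_inv]
  have : (fun t => unitImpulse k (t + 1)) = 0 := by
    ext t
    simp [unitImpulse]
  rw [this, zTransform_zero, mul_zero, add_zero]
  simp [unitImpulse]

theorem zTransform_advance₁ (β : ℝ) {x : ℤ → ℕ → ℝ} {k : ℤ} (h0 : x k 0 = 0) :
    zTransform (advance₁ β x k) = (zVar ℝ - const β) * zTransform (x k) := by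
  unfold advance₁
  rw [zTransform_sub, zTransform_succ, zTransform_const_mul, h0, map_zero]
  ring

theorem zTransform_advance₂_eq (α κ : ℝ) (x : ℤ → ℕ → ℝ) (k : ℤ) :
    zTransform (advance₂ α κ x k) = zVar ℝ * (zTransform (x k) - const (x k 0)) -
      const α * (zTransform (x k) +
        const κ * (zTransform (x (k - 1)) + zTransform (x (k + 1)))) := by
  unfold advance₂
  rw [zTransform_sub, zTransform_succ, zTransform_const_mul, zTransform_add, zTransform_const_mul,
    zTransform_add]

theorem zTransform_advance₂ (α κ : ℝ) {x : ℤ → ℕ → ℝ} {k : ℤ} (h0 : x k 0 = 0) :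
    zTransform (advance₂ α κ x k) = (zVar ℝ - const α) * zTransform (x k) +
      -const (α * κ) * (zTransform (x (k - 1)) + zTransform (x (k + 1))) := by
  rw [zTransform_advance₂_eq, h0]
  simp only [const, map_zero, map_mul]
  ring

/-- The transfer function at each site is stable and rational. -/
def SiteStable (x : ℤ → ℕ → ℝ) : Prop := ∀ k, zTransform (x k) ∈ stableRational ℝ

theorem siteStable_unitImpulse : SiteStable unitImpulse := fun k => by
  rw [zTransform_unitImpulse]
  exact C_mem_stableRational _

theorem SiteStable.advance₁ {x : ℤ → ℕ → ℝ} (h : SiteStable x) (β : ℝ) :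
    SiteStable (advance₁ β x) := fun k => by
  unfold SpatialSL.advance₁
  rw [zTransform_sub, zTransform_succ, zTransform_const_mul]
  exact sub_mem (mul_mem zVar_mem_stableRational (sub_mem (h k) (C_mem_stableRational _)))
    (mul_mem (C_mem_stableRational _) (h k))

theorem SiteStable.advance₂ {x : ℤ → ℕ → ℝ} (h : SiteStable x) (α κ : ℝ) :
    SiteStable (advance₂ α κ x) := fun k => by
  rw [zTransform_advance₂_eq]
  exact sub_mem (mul_mem zVar_mem_stableRational (sub_mem (h k) (C_mem_stableRational _)))
    (mul_mem (C_mem_stableRational _) (add_mem (h k)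
      (mul_mem (C_mem_stableRational _) (add_mem (h _) (h _)))))

theorem SiteStable.sub {x y : ℤ → ℕ → ℝ} (hx : SiteStable x) (hy : SiteStable y) :
    SiteStable (x - y) := fun k => by
  have := zTransform_sub (x k) (y k)
  rw [show (x - y) k = fun t => x k t - y k t from rfl, this]
  exact sub_mem (hx k) (hy k)

theorem SiteStable.add {x y : ℤ → ℕ → ℝ} (hx : SiteStable x) (hy : SiteStable y) :
    SiteStable (x + y) := fun k => by
  have := zTransform_add (x k) (y k)
  rw [show (x + y) k = fun t => x k t + y k t from rfl, this]
  exact add_mem (hx k) (hy k)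

/-! ### Spatio-temporal convolution -/

/-- The output `∑_{τ ≤ t} ∑ⱼ K_{k-j}(t-τ) yⱼ(τ)` of a causal LTSI system. -/
def conv (K y : ℤ → ℕ → ℝ) (k : ℤ) (t : ℕ) : ℝ :=
  ∑ τ ∈ Finset.range (t + 1), ∑' j : ℤ, K (k - j) (t - τ) * y j τ

theorem HasExtent.summable_mul {E : ℕ} {y : ℤ → ℕ → ℝ} (hy : HasExtent E y) (a : ℤ → ℝ) (t : ℕ) :
    Summable fun j => a j * y j t := by
  refine summable_of_ne_finset_zero (s := Finset.Icc (-(E : ℤ)) E) fun k hk => ?_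
  rw [Finset.mem_Icc, ← abs_le] at hk
  rw [hy.apply (not_le.mp hk), mul_zero]

theorem HasExtent.tsum_mul {E : ℕ} {y : ℤ → ℕ → ℝ} (hy : HasExtent E y) (a : ℤ → ℝ) (t : ℕ) :
    ∑' j, a j * y j t = ∑ j ∈ Finset.Icc (-(E : ℤ)) E, a j * y j t := by
  refine tsum_eq_sum fun k hk => ?_
  rw [Finset.mem_Icc, ← abs_le] at hk
  rw [hy.apply (not_le.mp hk), mul_zero]

theorem conv_succ_of_zero (K : ℤ → ℕ → ℝ) {y : ℤ → ℕ → ℝ} (h0 : ∀ k, y k 0 = 0) (k : ℤ) (t : ℕ) :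
    conv K y k (t + 1) = conv K (fun j τ => y j (τ + 1)) k t := by
  unfold conv
  rw [Finset.sum_range_succ']
  simp [h0]

theorem conv_zero_of_zero (K : ℤ → ℕ → ℝ) {y : ℤ → ℕ → ℝ} (h0 : ∀ k, y k 0 = 0) (k : ℤ) :
    conv K y k 0 = 0 := by
  simp [conv, h0]

theorem conv_shift (K y : ℤ → ℕ → ℝ) (c k : ℤ) (t : ℕ) :
    conv K (fun j τ => y (j + c) τ) k t = conv K y (k + c) t := by
  unfold conv
  refine Finset.sum_congr rfl fun τ _ => ?_
  rw [← (Equiv.addRight c).tsum_eq fun j => K (k + c - j) (t - τ) * y j τ]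
  simp only [Equiv.coe_addRight, add_sub_add_right_eq_sub]

theorem conv_const_mul (K y : ℤ → ℕ → ℝ) (c : ℝ) (k : ℤ) (t : ℕ) :
    conv K (fun j τ => c * y j τ) k t = c * conv K y k t := by
  unfold conv
  rw [Finset.mul_sum]
  refine Finset.sum_congr rfl fun τ _ => ?_
  rw [← tsum_mul_left]
  exact tsum_congr fun j => by ring

theorem conv_add (K : ℤ → ℕ → ℝ) {E F : ℕ} {x y : ℤ → ℕ → ℝ} (hx : HasExtent E x)
    (hy : HasExtent F y) (k : ℤ) (t : ℕ) :
    conv K (fun j τ => x j τ + y j τ) k t = conv K x k t + conv K y k t := by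
  unfold conv
  rw [← Finset.sum_add_distrib]
  refine Finset.sum_congr rfl fun τ _ => ?_
  rw [← (hx.summable_mul _ _).tsum_add (hy.summable_mul _ _)]
  exact tsum_congr fun j => by ring

theorem conv_sub (K : ℤ → ℕ → ℝ) {E F : ℕ} {x y : ℤ → ℕ → ℝ} (hx : HasExtent E x)
    (hy : HasExtent F y) (k : ℤ) (t : ℕ) :
    conv K (fun j τ => x j τ - y j τ) k t = conv K x k t - conv K y k t := by
  unfold conv
  rw [← Finset.sum_sub_distrib]
  refine Finset.sum_congr rfl fun τ _ => ?_
  rw [← (hx.summable_mul _ _).tsum_sub (hy.summable_mul _ _)]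
  exact tsum_congr fun j => by ring

theorem HasExtent.succ {E : ℕ} {x : ℤ → ℕ → ℝ} (h : HasExtent E x) :
    HasExtent E fun k t => x k (t + 1) :=
  HasExtent.of_apply fun _ hk _ => h.apply hk _

theorem HasExtent.const_mul {E : ℕ} {x : ℤ → ℕ → ℝ} (h : HasExtent E x) (c : ℝ) :
    HasExtent E fun k t => c * x k t :=
  HasExtent.of_apply fun _ hk _ => by rw [h.apply hk, mul_zero]

theorem HasExtent.shift {E : ℕ} {x : ℤ → ℕ → ℝ} (h : HasExtent E x) (c : ℤ) :
    HasExtent (E + c.natAbs) fun k t => x (k + c) t := by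
  refine HasExtent.of_apply fun k hk t => h.apply ?_ t
  push_cast at hk
  have := abs_sub_abs_le_abs_sub k (-c)
  rw [abs_neg, sub_neg_eq_add] at this
  omega

theorem conv_advance₁ (K : ℤ → ℕ → ℝ) {E : ℕ} {y : ℤ → ℕ → ℝ} (hy : HasExtent E y)
    (h0 : ∀ k, y k 0 = 0) (β : ℝ) : conv K (advance₁ β y) = advance₁ β (conv K y) := by
  ext k t
  unfold advance₁
  rw [conv_sub K hy.succ (hy.const_mul β), conv_const_mul, conv_succ_of_zero K h0]

theorem conv_advance₂ (K : ℤ → ℕ → ℝ) {E : ℕ} {y : ℤ → ℕ → ℝ} (hy : HasExtent E y)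
    (h0 : ∀ k, y k 0 = 0) (α κ : ℝ) : conv K (advance₂ α κ y) = advance₂ α κ (conv K y) := by
  ext k t
  have hm := hy.shift (-1)
  have hp := hy.shift 1
  have hmp : HasExtent (E + 1) fun j τ => y (j + -1) τ + y (j + 1) τ := hm.add hp
  have hall : HasExtent (E + 1) fun j τ => y j τ + κ * (y (j + -1) τ + y (j + 1) τ) :=
    (hy.mono (Nat.le_succ E)).add (hmp.const_mul κ)
  simp only [advance₂, sub_eq_add_neg _ (1 : ℤ)]
  unfold advance₂
  simp only [sub_eq_add_neg _ (1 : ℤ)]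
  rw [conv_sub K hy.succ (hall.const_mul α), conv_const_mul, conv_add K hy (hmp.const_mul κ),
    conv_const_mul, conv_add K hm hp, conv_shift, conv_shift, conv_succ_of_zero K h0]

/-- A response that starts with the delayed unit impulse `z⁻²` can be deconvolved recursively. -/
theorem conv_add_two (K : ℤ → ℕ → ℝ) {r : ℤ → ℕ → ℝ} (h0 : ∀ k, r k 0 = 0) (h1 : ∀ k, r k 1 = 0)
    (h2 : ∀ k, r k 2 = if k = 0 then 1 else 0) (k : ℤ) (t : ℕ) :
    conv K r k (t + 2)
      = K k t + ∑ τ ∈ Finset.range t, ∑' j : ℤ, K (k - j) (t - 1 - τ) * r j (τ + 3) := by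
  rw [conv_succ_of_zero K h0, conv_succ_of_zero K h1]
  unfold conv
  rw [Finset.sum_range_succ', add_comm]
  congr 1
  · have : ∀ j : ℤ, K (k - j) (t - 0) * r j (0 + 1 + 1) = if j = 0 then K k t else 0 := by
      intro j
      rw [h2]
      split_ifs with hj
      · simp [hj]
      · simp
    simp only [this, tsum_ite_eq]
  · refine Finset.sum_congr rfl fun τ _ => tsum_congr fun j => ?_
    rw [show t - (τ + 1) = t - 1 - τ by omega]

theorem conv_left_injective {K K' r : ℤ → ℕ → ℝ} (h0 : ∀ k, r k 0 = 0) (h1 : ∀ k, r k 1 = 0)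
    (h2 : ∀ k, r k 2 = if k = 0 then 1 else 0) (h : conv K r = conv K' r) : K = K' := by
  have key : ∀ t k, K k t = K' k t := by
    intro t
    induction t using Nat.strong_induction_on with
    | _ t ih =>
      intro k
      have hk := congrFun (congrFun h k) (t + 2)
      rw [conv_add_two K h0 h1 h2, conv_add_two K' h0 h1 h2] at hk
      have hs : ∑ τ ∈ Finset.range t, ∑' j : ℤ, K (k - j) (t - 1 - τ) * r j (τ + 3)
          = ∑ τ ∈ Finset.range t, ∑' j : ℤ, K' (k - j) (t - 1 - τ) * r j (τ + 3) := by
        refine Finset.sum_congr rfl fun τ hτ => tsum_congr fun j => ?_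
        rw [Finset.mem_range] at hτ
        rw [ih (t - 1 - τ) (by omega)]
      rw [hs] at hk
      exact add_right_cancel hk
  ext k t
  exact key t k

/-- The solution `K` of `conv K r = m`, when `r` starts with the delayed unit impulse `z⁻²`. -/
def deconv (r m : ℤ → ℕ → ℝ) : ℕ → ℤ → ℝ
  | t => fun k => m k (t + 2) - ∑ τ : Fin t, ∑' j : ℤ, deconv r m (t - 1 - τ) (k - j) * r j (τ + 3)
  termination_by t => t
  decreasing_by omega

theorem deconv_eq (r m : ℤ → ℕ → ℝ) (t : ℕ) (k : ℤ) :
    deconv r m t k = m k (t + 2) -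
      ∑ τ ∈ Finset.range t, ∑' j : ℤ, deconv r m (t - 1 - τ) (k - j) * r j (τ + 3) := by
  rw [deconv, Finset.sum_range]

theorem summable_deconv {E F : ℕ} {r m : ℤ → ℕ → ℝ} (hr : HasExtent E r) (hm : HasExtent F m)
    (t : ℕ) : Summable (deconv r m t) := by
  induction t using Nat.strong_induction_on with
  | _ t ih =>
    have : deconv r m t = fun k => m k (t + 2) - ∑ τ ∈ Finset.range t,
        ∑ j ∈ Finset.Icc (-(E : ℤ)) E, deconv r m (t - 1 - τ) (k - j) * r j (τ + 3) := by
      ext k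
      rw [deconv_eq]
      congr 1
      refine Finset.sum_congr rfl fun τ _ => ?_
      exact hr.tsum_mul (fun j => deconv r m (t - 1 - τ) (k - j)) (τ + 3)
    rw [this]
    refine Summable.sub (by simpa using hm.summable_mul 1 (t + 2)) ?_
    refine summable_sum fun τ hτ => summable_sum fun j _ => ?_
    rw [Finset.mem_range] at hτ
    refine Summable.mul_right _ ?_
    exact (Equiv.subRight j).summable_iff.mpr (ih (t - 1 - τ) (by omega))

theorem conv_deconv {r m : ℤ → ℕ → ℝ} (h0 : ∀ k, r k 0 = 0) (h1 : ∀ k, r k 1 = 0)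
    (h2 : ∀ k, r k 2 = if k = 0 then 1 else 0) (hm0 : ∀ k, m k 0 = 0) (hm1 : ∀ k, m k 1 = 0) :
    conv (fun k t => deconv r m t k) r = m := by
  ext k t
  match t with
  | 0 => rw [conv_zero_of_zero _ h0, hm0]
  | 1 => rw [conv_succ_of_zero _ h0, conv_zero_of_zero _ h1, hm1]
  | t + 2 =>
    rw [conv_add_two _ h0 h1 h2]
    rw [deconv_eq]
    ring

/-! ### The closed loop -/

section Loop

variable {α β κ : ℝ} {K : Controller}

theorem control_eq_conv (w : Dist → ℤ → ℕ → ℝ) :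
    control α β κ K w = conv K.ker (measurement α β κ K w) := by
  ext k t
  unfold control conv
  rw [Finset.sum_range]

/-- The state recursion has a unique solution. -/
theorem state_eq_of_recursion {w : Dist → ℤ → ℕ → ℝ} {a b : ℤ → ℕ → ℝ} (ha0 : ∀ k, a k 0 = 0)
    (hb0 : ∀ k, b k 0 = 0) (ha : ∀ k t, a k (t + 1) = β * a k t + b k t + w .x1 k t)
    (hb : ∀ k t, b k (t + 1) = α * (b k t + κ * (b (k - 1) t + b (k + 1) t))
      + w .x2 k t + w .u k t + conv K.ker (fun j τ => a j τ + w .y j τ) k t) (t : ℕ) (k : ℤ) :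
    state α β κ K w t k = (a k t, b k t) := by
  induction t using Nat.strong_induction_on generalizing k with
  | _ t ih =>
    match t with
    | 0 => rw [state_zero, ha0, hb0]
    | t + 1 =>
      have hu : control α β κ K w k t = conv K.ker (fun j τ => a j τ + w .y j τ) k t := by
        rw [control_eq_conv]
        unfold conv
        refine Finset.sum_congr rfl fun τ hτ => tsum_congr fun j => ?_
        rw [measurement, ih τ (Finset.mem_range.mp hτ)]
      have iht := ih t (Nat.lt_succ_self t)
      rw [state_succ, hu, iht, iht, iht, ha, hb]

theorem response_x1_zero (c : Dist) (k : ℤ) : response α β κ K c .x1 k 0 = 0 := by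
  simp [response, state_zero]

theorem response_x2_zero (c : Dist) (k : ℤ) : response α β κ K c .x2 k 0 = 0 := by
  simp [response, state_zero]

theorem response_x1_succ (c : Dist) (k : ℤ) (t : ℕ) :
    response α β κ K c .x1 k (t + 1) =
      β * response α β κ K c .x1 k t + response α β κ K c .x2 k t + impulse c .x1 k t := by
  simp [response, state_succ]

theorem response_x2_succ (c : Dist) (k : ℤ) (t : ℕ) :
    response α β κ K c .x2 k (t + 1) =
      α * (response α β κ K c .x2 k t + κ * (response α β κ K c .x2 (k - 1) t
        + response α β κ K c .x2 (k + 1) t))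
      + impulse c .x2 k t + impulse c .u k t + response α β κ K c .u k t := by
  simp [response, state_succ]

theorem response_y (c : Dist) (k : ℤ) (t : ℕ) :
    response α β κ K c .y k t = response α β κ K c .x1 k t + impulse c .y k t :=
  rfl

theorem response_u (c : Dist) :
    response α β κ K c .u = conv K.ker (response α β κ K c .y) :=
  control_eq_conv _

theorem impulse_self (c : Dist) : impulse c c = unitImpulse := by
  ext k t
  simp [impulse, unitImpulse]

theorem impulse_of_ne {c c' : Dist} (h : c' ≠ c) : impulse c c' = 0 := by
  ext k t
  simp [impulse, h]

variable (α β κ) in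
/-- The map `(z - σ) (z - β) r - 1`. -/
def controlMap (r : ℤ → ℕ → ℝ) : ℤ → ℕ → ℝ := advance₂ α κ (advance₁ β r) - unitImpulse

variable (α β κ) in
/-- All closed-loop maps, expressed through the map `r` from `w^{x,2}` to `x¹`. -/
def loopMap (r : ℤ → ℕ → ℝ) : Dist → Signal → ℤ → ℕ → ℝ
  | .x1, .x1 => advance₂ α κ r
  | .x1, .x2 => controlMap α β κ r
  | .x1, .u => advance₂ α κ (controlMap α β κ r)
  | .x1, .y => advance₂ α κ r
  | .x2, .x1 => r
  | .x2, .x2 => advance₁ β r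
  | .x2, .u => controlMap α β κ r
  | .x2, .y => r
  | .u, .x1 => r
  | .u, .x2 => advance₁ β r
  | .u, .u => controlMap α β κ r
  | .u, .y => r
  | .y, .x1 => controlMap α β κ r
  | .y, .x2 => advance₁ β (controlMap α β κ r)
  | .y, .u => advance₂ α κ (advance₁ β (controlMap α β κ r))
  | .y, .y => controlMap α β κ r + unitImpulse

theorem response_eq_of_state_eq {c : Dist} {a b : ℤ → ℕ → ℝ}
    (h : ∀ t k, state α β κ K (impulse c) t k = (a k t, b k t)) :
    response α β κ K c .x1 = a ∧ response α β κ K c .x2 = b ∧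
      response α β κ K c .y = a + impulse c .y ∧
      response α β κ K c .u = conv K.ker (a + impulse c .y) := by
  have h1 : response α β κ K c .x1 = a := by
    ext k t
    simp [response, h]
  have hy : response α β κ K c .y = a + impulse c .y := by
    rw [← h1]
    rfl
  refine ⟨h1, ?_, hy, ?_⟩
  · ext k t
    simp [response, h]
  · rw [response_u, hy]

/-- If `r` has finite extent and solves the loop equations for a disturbance `w^{x,2}`, then it
determines all closed-loop maps. -/
theorem response_eq_loopMap {r : ℤ → ℕ → ℝ} {E : ℕ} (hr : HasExtent E r) (h0 : ∀ k, r k 0 = 0)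
    (h1 : ∀ k, r k 1 = 0) (hK : conv K.ker r = controlMap α β κ r) :
    response α β κ K = loopMap α β κ r := by
  have hm0 : ∀ k, controlMap α β κ r k 0 = 0 := fun k => by
    rw [← hK, conv_zero_of_zero _ h0]
  have hm1 : ∀ k, controlMap α β κ r k 1 = 0 := fun k => by
    rw [← hK, conv_succ_of_zero _ h0, conv_zero_of_zero _ h1]
  have hadv0 : ∀ k, advance₁ β r k 0 = 0 := fun k => by simp [advance₁, h0, h1]
  have hconv2 : conv K.ker (advance₂ α κ r) = advance₂ α κ (controlMap α β κ r) := by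
    rw [conv_advance₂ _ hr h0, hK]
  have hconv12 : conv K.ker (advance₂ α κ (advance₁ β r))
      = advance₂ α κ (advance₁ β (controlMap α β κ r)) := by
    rw [conv_advance₂ _ (hr.advance₁ β) hadv0, conv_advance₁ _ hr h0, hK]
  have hm : controlMap α β κ r + unitImpulse = advance₂ α κ (advance₁ β r) := by
    rw [controlMap, sub_add_cancel]
  have hx1 := response_eq_of_state_eq (α := α) (β := β) (κ := κ) (K := K) (c := .x1)
    (state_eq_of_recursion (a := advance₂ α κ r) (b := controlMap α β κ r)
      (fun k => by simp [advance₂, h0, h1]) hm0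
      (fun k t => by
        rw [impulse_self, controlMap, advance₂_advance₁, Pi.sub_apply, Pi.sub_apply]
        unfold advance₁
        ring)
      (fun k t => by
        rw [impulse_of_ne (by decide), impulse_of_ne (by decide), impulse_of_ne (by decide)]
        simp only [Pi.zero_apply, add_zero]
        rw [hconv2]
        unfold advance₂
        ring))
  have hx2 : ∀ c, c = Dist.x2 ∨ c = Dist.u → ∀ t k,
      state α β κ K (impulse c) t k = (r k t, advance₁ β r k t) := by
    intro c hc
    have hw : ∀ k t, impulse c .x2 k t + impulse c .u k t = unitImpulse k t := by
      intro k t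
      rcases hc with rfl | rfl <;> simp [impulse, unitImpulse]
    have hw1 : impulse c .x1 = 0 := impulse_of_ne (by rcases hc with rfl | rfl <;> decide)
    have hwy : impulse c .y = 0 := impulse_of_ne (by rcases hc with rfl | rfl <;> decide)
    refine state_eq_of_recursion h0 hadv0 (fun k t => ?_) (fun k t => ?_)
    · rw [hw1, Pi.zero_apply, Pi.zero_apply]
      unfold advance₁
      ring
    · rw [hwy, add_assoc (α * _), hw]
      simp only [Pi.zero_apply, add_zero]
      rw [hK, controlMap, Pi.sub_apply, Pi.sub_apply]
      unfold advance₂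
      ring
  have hxx := response_eq_of_state_eq (hx2 .x2 (Or.inl rfl))
  have hxu := response_eq_of_state_eq (hx2 .u (Or.inr rfl))
  have hxy := response_eq_of_state_eq (α := α) (β := β) (κ := κ) (K := K) (c := .y)
    (state_eq_of_recursion (a := controlMap α β κ r) (b := advance₁ β (controlMap α β κ r))
      hm0 (fun k => by simp [advance₁, hm0, hm1])
      (fun k t => by
        rw [impulse_of_ne (by decide)]
        simp [advance₁])
      (fun k t => by
        rw [impulse_of_ne (by decide), impulse_of_ne (by decide), impulse_self]
        simp only [Pi.zero_apply, add_zero]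
        have := congrFun (congrFun hconv12 k) t
        rw [← hm] at this
        refine Eq.trans ?_ (congrArg _ this.symm)
        unfold advance₂
        ring))
  rw [impulse_of_ne (by decide), add_zero] at hx1 hxx hxu
  rw [impulse_self, hm, hconv12] at hxy
  rw [hconv2] at hx1
  rw [hK] at hxx hxu
  funext c s
  cases c <;> cases s <;> simp only [loopMap, hx1, hxx, hxu, hxy, hm]

theorem controlMap_response (k : ℤ) (t : ℕ) :
    controlMap α β κ (response α β κ K .x2 .x1) k t = response α β κ K .x2 .u k t := by
  have hadv : advance₁ β (response α β κ K .x2 .x1) = response α β κ K .x2 .x2 := by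
    ext k t
    rw [advance₁, response_x1_succ, impulse_of_ne (by decide)]
    simp
  rw [controlMap, hadv, Pi.sub_apply, Pi.sub_apply, advance₂, response_x2_succ, impulse_self,
    impulse_of_ne (by decide), Pi.zero_apply, Pi.zero_apply]
  ring

theorem conv_response :
    conv K.ker (response α β κ K .x2 .x1) = controlMap α β κ (response α β κ K .x2 .x1) := by
  have hy : response α β κ K .x2 .y = response α β κ K .x2 .x1 := by
    ext j τ
    rw [response_y, impulse_of_ne (by decide)]
    simp
  ext k t
  rw [controlMap_response, response_u, hy]

theorem response_x2_x1_one (k : ℤ) : response α β κ K .x2 .x1 k 1 = 0 := by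
  rw [response_x1_succ, response_x1_zero, response_x2_zero, impulse_of_ne (by decide)]
  simp

theorem response_eq_loopMap_of_hasExtent {E : ℕ} (h : HasExtent E (response α β κ K .x2 .x1)) :
    response α β κ K = loopMap α β κ (response α β κ K .x2 .x1) :=
  response_eq_loopMap h (response_x1_zero _) response_x2_x1_one conv_response

/-! ### The parametrization by `f` -/

variable (α β κ) in
/-- The impulse response of `z⁻² + z⁻³ (σ + β) + z⁻⁴ φ`. -/
def paramResponse (φ : ℤ → ℕ → ℝ) (k : ℤ) : ℕ → ℝ
  | 0 => 0
  | 1 => 0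
  | 2 => if k = 0 then 1 else 0
  | 3 => if k = 0 then α + β else if |k| = 1 then α * κ else 0
  | t + 4 => φ k t

theorem zTransform_paramResponse (φ : ℤ → ℕ → ℝ) (k : ℤ) :
    zTransform (paramResponse α β κ φ k)
      = gEntry α β κ k + (zVar ℝ)⁻¹ ^ 4 * zTransform (φ k) := by
  have hz := zVar_ne_zero (𝕜 := ℝ)
  rw [zTransform_eq_add_inv, zTransform_eq_add_inv (fun t => paramResponse α β κ φ k (t + 1)),
    zTransform_eq_add_inv (fun t => paramResponse α β κ φ k (t + 1 + 1)),
    zTransform_eq_add_inv (fun t => paramResponse α β κ φ k (t + 1 + 1 + 1))]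
  simp only [paramResponse, map_zero, zero_add]
  unfold gEntry band
  by_cases h0 : k = 0
  · simp only [h0, if_true, map_one, const, map_add]
    field_simp
    ring
  · by_cases h1 : |k| = 1
    · simp only [h0, h1, if_true, if_false, map_zero, const]
      field_simp
      ring
    · simp only [h0, h1, if_false, map_zero, ite_self]
      ring

theorem controlMap_paramResponse_zero (φ : ℤ → ℕ → ℝ) (k : ℤ) :
    controlMap α β κ (paramResponse α β κ φ) k 0 = 0 := by
  simp [controlMap, advance₂, advance₁, paramResponse, unitImpulse]

theorem controlMap_paramResponse_one (φ : ℤ → ℕ → ℝ) (k : ℤ) :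
    controlMap α β κ (paramResponse α β κ φ) k 1 = 0 := by
  simp only [controlMap, advance₂, advance₁, paramResponse, unitImpulse, Pi.sub_apply]
  by_cases h0 : k = 0
  · simp [h0]
  · by_cases h1 : |k| = 1
    · rcases (abs_eq zero_le_one).mp h1 with rfl | rfl <;> simp
    · have h2 : k - 1 ≠ 0 := by
        intro h
        exact h1 (by rw [show k = 1 by omega]; rfl)
      have h3 : k + 1 ≠ 0 := by
        intro h
        exact h1 (by rw [show k = -1 by omega]; rfl)
      simp [h0, h1, h2, h3]

theorem response_eq_paramResponse :
    response α β κ K .x2 .x1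
      = paramResponse α β κ fun k t => response α β κ K .x2 .x1 k (t + 4) := by
  set r := response α β κ K .x2 .x1 with hr
  have h0 : ∀ k, r k 0 = 0 := response_x1_zero _
  have h1 : ∀ k, r k 1 = 0 := response_x2_x1_one
  have hm0 : ∀ k, controlMap α β κ r k 0 = 0 := fun k => by
    rw [← conv_response, conv_zero_of_zero _ h0]
  have hm1 : ∀ k, controlMap α β κ r k 1 = 0 := fun k => by
    rw [← conv_response, conv_succ_of_zero _ h0, conv_zero_of_zero _ h1]
  have h2 : ∀ k, r k 2 = if k = 0 then 1 else 0 := by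
    intro k
    have := hm0 k
    simp [controlMap, advance₂, advance₁, unitImpulse, h0, h1] at this
    linarith
  have h3 : ∀ k, r k 3 = paramResponse α β κ (fun k t => r k (t + 4)) k 3 := by
    intro k
    have h := hm1 k
    have h' := controlMap_paramResponse_one (α := α) (β := β) (κ := κ) (fun k t => r k (t + 4)) k
    simp only [controlMap, advance₂, advance₁, Pi.sub_apply, h1, h2] at h h'
    simp only [paramResponse] at h' ⊢
    linarith
  ext k t
  match t with
  | 0 => exact h0 k
  | 1 => exact h1 k
  | 2 => exact h2 k
  | 3 => exact h3 k
  | t + 4 => rfl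

theorem parameter_eq (k : ℤ) :
    parameter α β κ K k = zTransform fun t => response α β κ K .x2 .x1 k (t + 4) := by
  have h : (fun t => slR α β κ K k t 0 1) = response α β κ K .x2 .x1 k := by
    ext t
    simp [slR]
  have hz := zVar_ne_zero (𝕜 := ℝ)
  unfold parameter
  rw [h]
  conv_lhs => rw [response_eq_paramResponse]
  rw [zTransform_paramResponse, add_sub_cancel_left, ← mul_assoc, inv_pow,
    mul_inv_cancel₀ (pow_ne_zero _ hz), one_mul]

theorem hasExtent_paramResponse {E : ℕ} {φ : ℤ → ℕ → ℝ} (h : HasExtent E φ) :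
    HasExtent (max E 1) (paramResponse α β κ φ) := by
  refine HasExtent.of_apply fun k hk t => ?_
  push_cast at hk
  have h1 : |k| ≠ 1 := by omega
  have h0 : k ≠ 0 := by
    rintro rfl
    simp at hk
  match t with
  | 0 => rfl
  | 1 => rfl
  | 2 => simp [paramResponse, h0]
  | 3 => simp [paramResponse, h0, h1]
  | t + 4 => exact h.apply (by omega) t

theorem hasExtent_response_of_parameter {E : ℕ} (h : HasExtent E (parameter α β κ K)) :
    HasExtent (max E 1) (response α β κ K .x2 .x1) := by
  rw [response_eq_paramResponse]
  refine hasExtent_paramResponse fun k hk => ?_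
  have hk' := h k hk
  rw [parameter_eq, ← zTransform_zero] at hk'
  exact zTransform_injective hk'

theorem hasExtent_parameter_of_response {E : ℕ} (h : HasExtent E (response α β κ K .x2 .x1)) :
    HasExtent E (parameter α β κ K) := by
  intro k hk
  rw [parameter_eq, h k hk]
  exact zTransform_zero

/-! ### Extents and stability of the closed-loop maps -/

theorem hasExtent_controlMap {E : ℕ} {r : ℤ → ℕ → ℝ} (hr : HasExtent E r) :
    HasExtent (E + 1) (controlMap α β κ r) :=
  ((hr.advance₁ β).advance₂ α κ).sub (hasExtent_unitImpulse _)

theorem hasExtent_loopMap {E : ℕ} {r : ℤ → ℕ → ℝ} (hr : HasExtent E r) (c : Dist) (s : Signal) :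
    HasExtent (E + 2) (loopMap α β κ r c s) := by
  have hm := hasExtent_controlMap (α := α) (β := β) (κ := κ) hr
  cases c <;> cases s
  · exact (hr.advance₂ α κ).mono (by omega)
  · exact hm.mono (by omega)
  · exact hm.advance₂ α κ
  · exact (hr.advance₂ α κ).mono (by omega)
  · exact hr.mono (by omega)
  · exact (hr.advance₁ β).mono (by omega)
  · exact hm.mono (by omega)
  · exact hr.mono (by omega)
  · exact hr.mono (by omega)
  · exact (hr.advance₁ β).mono (by omega)
  · exact hm.mono (by omega)
  · exact hr.mono (by omega)
  · exact hm.mono (by omega)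
  · exact (hm.advance₁ β).mono (by omega)
  · exact (hm.advance₁ β).advance₂ α κ
  · exact (hm.mono (by omega)).add (hasExtent_unitImpulse _)

theorem siteStable_loopMap {r : ℤ → ℕ → ℝ} (hr : SiteStable r) (c : Dist) (s : Signal) :
    SiteStable (loopMap α β κ r c s) := by
  have hm : SiteStable (controlMap α β κ r) :=
    ((hr.advance₁ β).advance₂ α κ).sub siteStable_unitImpulse
  cases c <;> cases s
  · exact hr.advance₂ α κ
  · exact hm
  · exact hm.advance₂ α κ
  · exact hr.advance₂ α κ
  · exact hr
  · exact hr.advance₁ β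
  · exact hm
  · exact hr
  · exact hr
  · exact hr.advance₁ β
  · exact hm
  · exact hr
  · exact hm
  · exact hm.advance₁ β
  · exact (hm.advance₁ β).advance₂ α κ
  · exact hm.add siteStable_unitImpulse

theorem slExtentBounds_of_response {E : ℕ} (hr : HasExtent E (response α β κ K .x2 .x1)) :
    SLExtentBounds α β κ (E + 1) (E + 2) K := by
  have h := response_eq_loopMap_of_hasExtent hr
  have hm := hasExtent_controlMap (α := α) (β := β) (κ := κ) hr
  have h11 : HasExtent (E + 1) (response α β κ K .x1 .x1) := by
    rw [h]
    exact hr.advance₂ α κ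
  have h21 : HasExtent (E + 1) (response α β κ K .x1 .x2) := by
    rw [h]
    exact hm
  have h22 : HasExtent (E + 1) (response α β κ K .x2 .x2) := by
    rw [h]
    exact (hr.advance₁ β).mono (by omega)
  have hn1 : HasExtent (E + 1) (response α β κ K .y .x1) := by
    rw [h]
    exact hm
  have hn2 : HasExtent (E + 1) (response α β κ K .y .x2) := by
    rw [h]
    exact hm.advance₁ β
  have hu : ∀ c, HasExtent (E + 2) (response α β κ K c .u) := by
    intro c
    rw [h]
    exact hasExtent_loopMap hr c .u
  refine ⟨fun k hk => ?_, fun k hk => ?_, fun k hk => ?_, fun k hk => ?_⟩ <;> funext t <;> ext i j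
  · have hk' : (E : ℤ) < |k| := lt_of_le_of_lt (by simp) hk
    fin_cases i <;> fin_cases j <;>
      simp [slR, h11.apply hk, h21.apply hk, h22.apply hk, hr.apply hk']
  · fin_cases i <;> fin_cases j <;> simp [slN, hn1.apply hk, hn2.apply hk]
  · fin_cases i
    fin_cases j <;> simp [slM, (hu _).apply hk]
  · fin_cases i; fin_cases j; simp [slL, (hu _).apply hk]

theorem SLExtentBounds.mono {a b a' b' : ℕ} (h : SLExtentBounds α β κ a b K) (ha : a ≤ a')
    (hb : b ≤ b') : SLExtentBounds α β κ a' b' K :=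
  ⟨h.1.mono ha, h.2.1.mono ha, h.2.2.1.mono hb, h.2.2.2.mono hb⟩

theorem SLExtentBounds.slFeasible {a b : ℕ} (h : SLExtentBounds α β κ a b K)
    (hK : InternallyStabilizing α β κ K) : SLFeasible α β κ K :=
  ⟨hK, ⟨a, h.1⟩, ⟨b, h.2.2.1⟩, ⟨a, h.2.1⟩, ⟨b, h.2.2.2⟩⟩

theorem hasExtent_response_of_slR {E : ℕ} (h : HasExtent E (slR α β κ K)) (i j : Fin 2) :
    HasExtent E fun k t => slR α β κ K k t i j := by
  refine HasExtent.of_apply fun k hk t => ?_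
  rw [h k hk]
  rfl

theorem slFeasible_iff : SLFeasible α β κ K ↔ ∃ E : ℕ, SLFeasibleAt α β κ E K := by
  refine ⟨fun h => ?_, fun ⟨E, h⟩ => h.1⟩
  obtain ⟨E, hE⟩ := h.2.1
  exact ⟨E, h, hasExtent_parameter_of_response (hasExtent_response_of_slR hE 0 1)⟩

theorem SLFeasibleAt.slExtentBounds {E : ℕ} (h : SLFeasibleAt α β κ E K) :
    SLExtentBounds α β κ (max (E + 1) 2) (max (E + 2) 3) K :=
  (slExtentBounds_of_response (hasExtent_response_of_parameter h.2)).mono (by omega) (by omega)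

theorem slFeasibleAt_iff_slExtentBounds {E : ℕ} (hE : 1 ≤ E) (hακ : α * κ ≠ 0) :
    SLFeasibleAt α β κ E K ↔
      InternallyStabilizing α β κ K ∧ SLExtentBounds α β κ (E + 1) (E + 2) K := by
  refine ⟨fun h => ⟨h.1.1, h.slExtentBounds.mono (by omega) (by omega)⟩, fun ⟨hK, hb⟩ => ?_⟩
  refine ⟨hb.slFeasible hK, hasExtent_parameter_of_response ?_⟩
  have hr : HasExtent (E + 1) (response α β κ K .x2 .x1) := hasExtent_response_of_slR hb.1 0 1
  have hr11 : HasExtent (E + 1) (response α β κ K .x1 .x1) := hasExtent_response_of_slR hb.1 0 0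
  rw [response_eq_loopMap_of_hasExtent hr] at hr11
  refine HasExtent.of_apply fun k hk t => ?_
  rcases lt_or_eq_of_le (Int.add_one_le_of_lt hk) with hlt | heq
  · exact hr.apply (by exact_mod_cast hlt) t
  rcases (abs_eq (by omega)).mp heq.symm with hk' | hk'
  · have h1 : ((E + 1 : ℕ) : ℤ) < |k + 1| := by rw [lt_abs]; push_cast; omega
    have h2 : ((E + 1 : ℕ) : ℤ) < |k + 1 + 1| := by rw [lt_abs]; push_cast; omega
    have h := hr11.apply h1 t
    simp only [loopMap, advance₂, hr.apply h1, hr.apply h2, add_sub_cancel_right] at h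
    have h' : α * κ * response α β κ K .x2 .x1 k t = 0 := by linarith
    exact (mul_eq_zero.mp h').resolve_left hακ
  · have h1 : ((E + 1 : ℕ) : ℤ) < |k - 1| := by rw [lt_abs]; push_cast; omega
    have h2 : ((E + 1 : ℕ) : ℤ) < |k - 1 - 1| := by rw [lt_abs]; push_cast; omega
    have h := hr11.apply h1 t
    simp only [loopMap, advance₂, hr.apply h1, hr.apply h2, sub_add_cancel] at h
    have h' : α * κ * response α β κ K .x2 .x1 k t = 0 := by linarith
    exact (mul_eq_zero.mp h').resolve_left hακ

/-! ### Controllers and decision variables -/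

theorem band_mem_stableRational {a b c : LaurentSeries ℝ} (ha : a ∈ stableRational ℝ)
    (hb : b ∈ stableRational ℝ) (hc : c ∈ stableRational ℝ) (k : ℤ) :
    band a b c k ∈ stableRational ℝ := by
  unfold band
  split_ifs
  exacts [ha, hb, hc, zero_mem _]

theorem gEntry_mem_stableRational (k : ℤ) : gEntry α β κ k ∈ stableRational ℝ :=
  mul_mem (pow_mem inv_zVar_mem_stableRational 3) (band_mem_stableRational
    (add_mem (add_mem zVar_mem_stableRational (C_mem_stableRational _)) (C_mem_stableRational _))
    (C_mem_stableRational _) (zero_mem _) k)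

theorem mapsTo_parameter (E : ℕ) :
    Set.MapsTo (fun K (k : Site E) => parameter α β κ K k)
      {K : Controller | SLFeasibleAt α β κ E K} (decisionSpace E) := by
  intro K hK k
  have hr := hasExtent_response_of_parameter hK.2
  have hs := hr.isRHinf_iff.mp (hK.1.1 .x2 .x1) k
  beta_reduce
  rw [parameter_eq, zTransform_mem_RHinf_iff, ← parameter_eq, parameter]
  refine mul_mem (pow_mem zVar_mem_stableRational 4) (sub_mem ?_ ?_)
  · have h : (fun t => slR α β κ K k t 0 1) = response α β κ K .x2 .x1 k := by
      ext t
      simp [slR]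
    rwa [h]
  · exact gEntry_mem_stableRational _

theorem response_add_four_injective {K' : Controller}
    (h : ∀ k t, response α β κ K .x2 .x1 k (t + 4) = response α β κ K' .x2 .x1 k (t + 4)) :
    K = K' := by
  have hr : response α β κ K .x2 .x1 = response α β κ K' .x2 .x1 := by
    rw [response_eq_paramResponse, response_eq_paramResponse (K := K')]
    simp only [h]
  have h2 : ∀ k, response α β κ K .x2 .x1 k 2 = if k = 0 then 1 else 0 := by
    intro k
    rw [response_eq_paramResponse]
    rfl
  refine Controller.ext (conv_left_injective (response_x1_zero (α := α) (β := β) (κ := κ) _)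
    response_x2_x1_one h2 ?_)
  rw [conv_response]
  rw [hr, conv_response]

theorem injOn_parameter (E : ℕ) :
    Set.InjOn (fun K (k : Site E) => parameter α β κ K k)
      {K : Controller | SLFeasibleAt α β κ E K} := by
  intro K hK K' hK' h
  have hp : ∀ k, parameter α β κ K k = parameter α β κ K' k := by
    intro k
    by_cases hk : k ∈ Finset.Icc (-(E : ℤ)) E
    · exact congrFun h ⟨k, hk⟩
    · rw [Finset.mem_Icc, ← abs_le, not_le] at hk
      rw [hK.2 k hk, hK'.2 k hk]
  refine response_add_four_injective (α := α) (β := β) (κ := κ) fun k t => ?_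
  have := hp k
  rw [parameter_eq, parameter_eq] at this
  exact congrFun (zTransform_injective this) t

theorem exists_controller {E : ℕ} {φ : ℤ → ℕ → ℝ} (hφ : HasExtent E φ) (hs : SiteStable φ) :
    ∃ K : Controller, SLFeasibleAt α β κ E K ∧ ∀ k, parameter α β κ K k = zTransform (φ k) := by
  set r := paramResponse α β κ φ with hrdef
  have hr : HasExtent (max E 1) r := hasExtent_paramResponse hφ
  have hm : HasExtent (max E 1 + 1) (controlMap α β κ r) := hasExtent_controlMap hr
  let K : Controller := ⟨fun k t => deconv r (controlMap α β κ r) t k, summable_deconv hr hm⟩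
  have hK : conv K.ker r = controlMap α β κ r :=
    conv_deconv (fun _ => rfl) (fun _ => rfl) (fun _ => rfl)
      (controlMap_paramResponse_zero φ) (controlMap_paramResponse_one φ)
  have hresp : response α β κ K = loopMap α β κ r :=
    response_eq_loopMap hr (fun _ => rfl) (fun _ => rfl) hK
  have hr12 : response α β κ K .x2 .x1 = r := by rw [hresp]; rfl
  have hparam : ∀ k, parameter α β κ K k = zTransform (φ k) := fun k => by
    rw [parameter_eq, hr12]
    rfl
  have hrs : SiteStable r := fun k => by
    rw [hrdef, zTransform_paramResponse]
    exact add_mem (gEntry_mem_stableRational k)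
      (mul_mem (pow_mem inv_zVar_mem_stableRational 4) (hs k))
  have hstab : InternallyStabilizing α β κ K := fun c s => by
    rw [hresp, (hasExtent_loopMap hr c s).isRHinf_iff]
    exact siteStable_loopMap hrs c s
  refine ⟨K, ⟨(slExtentBounds_of_response (hr12 ▸ hr)).slFeasible hstab, fun k hk => ?_⟩, hparam⟩
  rw [hparam, hφ k hk, zTransform_zero]

theorem surjOn_parameter (E : ℕ) :
    Set.SurjOn (fun K (k : Site E) => parameter α β κ K k)
      {K : Controller | SLFeasibleAt α β κ E K} (decisionSpace E) := by
  intro f hf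
  let φ : ℤ → ℕ → ℝ := fun k t =>
    if hk : k ∈ Finset.Icc (-(E : ℤ)) E then (f ⟨k, hk⟩).coeff t else 0
  have hφ : HasExtent E φ := HasExtent.of_apply fun k hk t => by
    have : k ∉ Finset.Icc (-(E : ℤ)) E := by
      rw [Finset.mem_Icc, ← abs_le]
      exact not_le.mpr hk
    simp only [φ, dif_neg this]
  have hfφ : ∀ k : Site E, zTransform (φ k) = f k := by
    rintro ⟨k, hk⟩
    rw [(mem_RHinf_iff.mp (hf ⟨k, hk⟩)).1.eq_zTransform]
    simp only [φ, dif_pos hk]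
  have hs : SiteStable φ := fun k => by
    by_cases hk : k ∈ Finset.Icc (-(E : ℤ)) E
    · rw [hfφ ⟨k, hk⟩]
      exact (mem_RHinf_iff.mp (hf ⟨k, hk⟩)).2
    · rw [Finset.mem_Icc, ← abs_le, not_le] at hk
      rw [hφ k hk, zTransform_zero]
      exact zero_mem _
  obtain ⟨K, hK, hp⟩ := exists_controller (α := α) (β := β) (κ := κ) hφ hs
  exact ⟨K, hK, funext fun k => (hp k).trans (hfφ k)⟩

theorem bijOn_parameter (E : ℕ) :
    Set.BijOn (fun K (k : Site E) => parameter α β κ K k)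
      {K : Controller | SLFeasibleAt α β κ E K} (decisionSpace E) :=
  ⟨mapsTo_parameter E, injOn_parameter E, surjOn_parameter E⟩

end Loop

/-! ### The model-matching cost -/

theorem sum_site_ite {F : ℕ} {x : ℤ → LaurentSeries ℝ} (hx : HasExtent F x) (a : LaurentSeries ℝ)
    (m : ℤ) :
    ∑ j : Site F, (if j.1 = m then a * x m else 0) = a * x m := by
  rw [Finset.sum_coe_sort (Finset.Icc (-(F : ℤ)) F) fun j => if j = m then a * x m else 0,
    Finset.sum_ite_eq']
  split_ifs with h
  · rfl
  · rw [Finset.mem_Icc, ← abs_le, not_le] at h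
    rw [hx m h, mul_zero]

theorem sum_band_mul {F : ℕ} {x : ℤ → LaurentSeries ℝ} (hx : HasExtent F x)
    (a b c : LaurentSeries ℝ) (k : ℤ) :
    ∑ j : Site F, band a b c (k - j.1) * x j.1
      = a * x k + b * (x (k - 1) + x (k + 1)) + c * (x (k - 1 - 1) + x (k + 1 + 1)) := by
  have hterm : ∀ j : ℤ, band a b c (k - j) * x j
      = (if j = k then a * x k else 0) + ((if j = k - 1 then b * x (k - 1) else 0)
        + (if j = k + 1 then b * x (k + 1) else 0))
        + ((if j = k - 1 - 1 then c * x (k - 1 - 1) else 0)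
        + (if j = k + 1 + 1 then c * x (k + 1 + 1) else 0)) := by
    intro j
    unfold band
    simp only [abs_eq (zero_le_one (α := ℤ)), abs_eq (zero_le_two (α := ℤ))]
    by_cases h0 : j = k
    · subst h0
      rw [if_pos (sub_self _), if_pos rfl, if_neg (by omega), if_neg (by omega),
        if_neg (by omega), if_neg (by omega)]
      ring
    by_cases h1 : j = k - 1
    · subst h1
      rw [if_neg (by omega), if_pos (by omega), if_neg (by omega), if_pos rfl, if_neg (by omega),
        if_neg (by omega), if_neg (by omega)]
      ring
    by_cases h2 : j = k + 1
    · subst h2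
      rw [if_neg (by omega), if_pos (by omega), if_neg (by omega), if_neg (by omega), if_pos rfl,
        if_neg (by omega), if_neg (by omega)]
      ring
    by_cases h3 : j = k - 1 - 1
    · subst h3
      rw [if_neg (by omega), if_neg (by omega), if_pos (by omega), if_neg (by omega),
        if_neg (by omega), if_neg (by omega), if_pos rfl, if_neg (by omega)]
      ring
    by_cases h4 : j = k + 1 + 1
    · subst h4
      rw [if_neg (by omega), if_neg (by omega), if_pos (by omega), if_neg (by omega),
        if_neg (by omega), if_neg (by omega), if_neg (by omega), if_pos rfl]
      ring
    rw [if_neg (by omega), if_neg (by omega), if_neg (by omega), if_neg h0, if_neg h1, if_neg h2,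
      if_neg h3, if_neg h4]
    ring
  simp only [hterm, Finset.sum_add_distrib, sum_site_ite hx]
  ring

theorem band_neg_one (k : ℤ) :
    band (-1) 0 0 k = -HahnSeries.C (if k = 0 then (1 : ℝ) else 0) := by
  unfold band
  split_ifs <;> simp

section Cost

variable {α β κ : ℝ}

variable (α β κ) in
/-- The six closed-loop maps that enter the cost, expressed through `r`. -/
def costResponse (r : ℤ → ℕ → ℝ) : CostMap → ℤ → ℕ → ℝ
  | .n1 => controlMap α β κ r
  | .r12 => r
  | .n2 => advance₁ β (controlMap α β κ r)
  | .r22 => advance₁ β r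
  | .l => advance₂ α κ (advance₁ β (controlMap α β κ r))
  | .m2 => controlMap α β κ r

theorem zTransform_controlMap {r : ℤ → ℕ → ℝ} (h0 : ∀ k, r k 0 = 0) (h1 : ∀ k, r k 1 = 0)
    (k : ℤ) :
    zTransform (controlMap α β κ r k) = (zVar ℝ - const β) * ((zVar ℝ - const α) *
      zTransform (r k) + -const (α * κ) * (zTransform (r (k - 1)) + zTransform (r (k + 1))))
      - HahnSeries.C (if k = 0 then 1 else 0) := by
  have hadv0 : ∀ k, advance₁ β r k 0 = 0 := fun k => by simp [advance₁, h0, h1]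
  have h := zTransform_sub (advance₂ α κ (advance₁ β r) k) (unitImpulse k)
  rw [controlMap]
  refine h.trans ?_
  rw [zTransform_unitImpulse, zTransform_advance₂ α κ (hadv0 k), zTransform_advance₁ β (h0 k),
    zTransform_advance₁ β (h0 _), zTransform_advance₁ β (h0 _)]
  ring

theorem hEntry_l (k : ℤ) :
    hEntry α β κ .l k = (zVar ℝ - const β) * ((zVar ℝ - const α) *
      -HahnSeries.C (if k = 0 then (1 : ℝ) else 0) + -const (α * κ) *
        (-HahnSeries.C (if k - 1 = 0 then (1 : ℝ) else 0)
          + -HahnSeries.C (if k + 1 = 0 then (1 : ℝ) else 0))) := by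
  simp only [hEntry, band, abs_eq (zero_le_one (α := ℤ)), ite_self]
  congr 1
  by_cases h0 : k = 0
  · simp [h0, const]
  by_cases h1 : k = 1
  · simp [h1, const]
    ring
  by_cases h2 : k = -1
  · simp [h2, const]
    ring
  have h1' : k - 1 ≠ 0 := by omega
  have h2' : k + 1 ≠ 0 := by omega
  simp [h0, h1, h2, h1', h2']

theorem zTransform_costResponse {F : ℕ} {r : ℤ → ℕ → ℝ} (hr : HasExtent F r)
    (h0 : ∀ k, r k 0 = 0) (h1 : ∀ k, r k 1 = 0) (hm0 : ∀ k, controlMap α β κ r k 0 = 0)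
    (hm1 : ∀ k, controlMap α β κ r k 1 = 0) (q : CostMap) (k : ℤ) :
    zTransform (costResponse α β κ r q k)
      = ∑ j : Site F, Vdiag α β κ q (k - j.1) * zTransform (r j.1) + hEntry α β κ q k := by
  have hx : HasExtent F fun j => zTransform (r j) := fun j hj => by
    simp only [hr j hj, zTransform_zero]
  have hadv0 : ∀ k, advance₁ β (controlMap α β κ r) k 0 = 0 := fun k => by
    simp [advance₁, hm0, hm1]
  have hsum := sum_band_mul hx
  have hm := zTransform_controlMap (α := α) (β := β) (κ := κ) h0 h1
  cases q
  · simp only [costResponse, Vdiag, hEntry, mul_assoc, ← Finset.mul_sum, hsum, hm, band_neg_one]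
    ring
  · simp only [costResponse, Vdiag, hEntry, hsum]
    ring
  · simp only [costResponse, Vdiag, hEntry, mul_assoc, ← Finset.mul_sum, hsum,
      zTransform_advance₁ β (hm0 k), hm, band_neg_one]
    ring
  · simp only [costResponse, Vdiag, hEntry, mul_assoc, ← Finset.mul_sum, hsum,
      zTransform_advance₁ β (h0 k)]
    ring
  · rw [hEntry_l]
    simp only [costResponse, Vdiag, mul_assoc, ← Finset.mul_sum, hsum,
      zTransform_advance₂ α κ (hadv0 k), zTransform_advance₁ β (hm0 _), hm, sub_add_cancel,
      add_sub_cancel_right]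
    ring
  · simp only [costResponse, Vdiag, hEntry, mul_assoc, ← Finset.mul_sum, hsum, hm, band_neg_one]
    ring

theorem hasExtent_costResponse {E : ℕ} {r : ℤ → ℕ → ℝ} (hr : HasExtent (E + 1) r) (q : CostMap) :
    HasExtent (E + q.offset) (costResponse α β κ r q) := by
  have hm := hasExtent_controlMap (α := α) (β := β) (κ := κ) hr
  cases q
  · exact hm
  · exact hr
  · exact hm.advance₁ β
  · exact hr.advance₁ β
  · exact (hm.advance₁ β).advance₂ α κ
  · exact hm

theorem tsum_sq_coeff_zTransform (g : ℕ → ℝ) :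
    ∑' t : ℤ, ENNReal.ofReal ((zTransform g).coeff t ^ 2) = ∑' t : ℕ, ENNReal.ofReal (g t ^ 2) := by
  have hinj : Function.Injective fun t : ℕ => (t : ℤ) := Nat.cast_injective
  rw [← hinj.tsum_eq]
  · simp only [coeff_zTransform]
  · intro t ht
    rw [Function.mem_support] at ht
    rcases lt_or_ge t 0 with h | h
    · rw [isCausal_zTransform g t h] at ht
      simp at ht
    · exact ⟨t.toNat, by simp [h]⟩

theorem HasExtent.sum_site_tsum {E : ℕ} {x : ℤ → ℕ → ℝ} (hx : HasExtent E x) :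
    ∑ k : Site E, ∑' t : ℤ, ENNReal.ofReal ((zTransform (x k.1)).coeff t ^ 2)
      = ∑' (k : ℤ) (t : ℕ), ENNReal.ofReal (x k t ^ 2) := by
  simp only [tsum_sq_coeff_zTransform]
  rw [Finset.sum_coe_sort (Finset.Icc (-(E : ℤ)) E)
    fun k => ∑' t : ℕ, ENNReal.ofReal (x k t ^ 2)]
  symm
  refine tsum_eq_sum fun k hk => ?_
  rw [Finset.mem_Icc, ← abs_le, not_le] at hk
  simp [hx.apply hk]

theorem mulVec_VSL_add_hSL (E : ℕ) (f : Site E → LaurentSeries ℝ) :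
    (VSL α β κ E).mulVec f + hSL α β κ E
      = (Vstack α β κ E).mulVec ((Smat E).mulVec f + gvec α β κ E) + hstack α β κ E := by
  unfold VSL hSL
  rw [← Matrix.mulVec_mulVec, Matrix.mulVec_add, add_assoc]

theorem mulVec_Smat_add_gvec (E : ℕ) {φ : ℤ → ℕ → ℝ} (hφ : HasExtent E φ) :
    (Smat E).mulVec (fun k : Site E => zTransform (φ k)) + gvec α β κ E
      = fun k => zTransform (paramResponse α β κ φ k.1) := by
  have hx : HasExtent E fun j => zTransform (φ j) := fun j hj => by
    simp only [hφ j hj, zTransform_zero]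
  funext k
  rw [zTransform_paramResponse, Pi.add_apply, gvec, add_comm]
  congr 1
  rw [← sum_site_ite hx]
  rw [Matrix.mulVec, dotProduct]
  refine Finset.sum_congr rfl fun j _ => ?_
  change (if k.1 = j.1 then (zVar ℝ)⁻¹ ^ 4 else 0) * zTransform (φ j) = _
  by_cases h : k.1 = j.1
  · rw [if_pos h, if_pos h.symm, h]
  · rw [if_neg h, if_neg (Ne.symm h), zero_mul]

theorem modelCost_eq (E : ℕ) {φ : ℤ → ℕ → ℝ} (hφ : HasExtent E φ) :
    modelCost α β κ E (fun k : Site E => zTransform (φ k))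
      = ∑ q : CostMap, ∑' (k : ℤ) (t : ℕ),
          ENNReal.ofReal (costResponse α β κ (paramResponse α β κ φ) q k t ^ 2) := by
  set r := paramResponse α β κ φ with hrdef
  have hr : HasExtent (E + 1) r := (hasExtent_paramResponse hφ).mono (by omega)
  have hrow : (VSL α β κ E).mulVec (fun k : Site E => zTransform (φ k)) + hSL α β κ E
      = fun i : Row E => zTransform (costResponse α β κ r i.1 i.2.1) := by
    rw [mulVec_VSL_add_hSL, mulVec_Smat_add_gvec E hφ]
    funext i
    rw [zTransform_costResponse hr (fun _ => rfl) (fun _ => rfl)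
      (controlMap_paramResponse_zero φ) (controlMap_paramResponse_one φ)]
    rfl
  unfold modelCost columnNormSq
  rw [hrow, Fintype.sum_sigma]
  refine Finset.sum_congr rfl fun q _ => ?_
  exact (hasExtent_costResponse hr q).sum_site_tsum

theorem sum_costMap (g : CostMap → ℝ≥0∞) :
    ∑ q, g q = g .n1 + g .r12 + g .n2 + g .r22 + g .l + g .m2 := by
  have : (Finset.univ : Finset CostMap) = {.n1, .r12, .n2, .r22, .l, .m2} := rfl
  rw [this]
  repeat rw [Finset.sum_insert (by decide)]
  rw [Finset.sum_singleton]
  ring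

theorem systemNormSq_closedLoop {K : Controller} {E : ℕ}
    (hr : HasExtent E (response α β κ K .x2 .x1)) :
    systemNormSq (closedLoop α β κ K)
      = ∑ q : CostMap, ∑' (k : ℤ) (t : ℕ),
          ENNReal.ofReal (costResponse α β κ (response α β κ K .x2 .x1) q k t ^ 2) := by
  rw [sum_costMap]
  simp only [← ENNReal.tsum_add]
  unfold systemNormSq
  refine tsum_congr fun k => tsum_congr fun t => ?_
  set r := response α β κ K .x2 .x1 with hrdef
  rw [← ENNReal.ofReal_add (by positivity) (by positivity),
    ← ENNReal.ofReal_add (by positivity) (by positivity),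
    ← ENNReal.ofReal_add (by positivity) (by positivity),
    ← ENNReal.ofReal_add (by positivity) (by positivity),
    ← ENNReal.ofReal_add (by positivity) (by positivity)]
  congr 1
  simp only [closedLoop, response_eq_loopMap_of_hasExtent hr, ← hrdef, loopMap, costResponse]
  simp [Matrix.trace, Matrix.mul_apply, Fin.sum_univ_succ]
  ring

theorem systemNorm_sq {m n : Type*} [Fintype m] [Fintype n] (G : ℤ → ℕ → Matrix m n ℝ) :
    systemNorm G ^ 2 = systemNormSq G := by
  unfold systemNorm
  rw [← ENNReal.rpow_natCast, ← ENNReal.rpow_mul]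
  norm_num

theorem SLFeasibleAt.systemNorm_sq_eq {K : Controller} {E : ℕ} (h : SLFeasibleAt α β κ E K) :
    systemNorm (closedLoop α β κ K) ^ 2
      = modelCost α β κ E (fun k : Site E => parameter α β κ K k) := by
  have hφ : HasExtent E fun k t => response α β κ K .x2 .x1 k (t + 4) := by
    intro k hk
    have hk' := h.2 k hk
    rw [parameter_eq, ← zTransform_zero] at hk'
    exact zTransform_injective hk'
  rw [systemNorm_sq, systemNormSq_closedLoop (hasExtent_response_of_parameter h.2)]
  simp only [parameter_eq]
  rw [modelCost_eq E hφ, ← response_eq_paramResponse]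

/-! ### Optimal values -/

theorem iInf_sq {ι : Sort*} (g : ι → ℝ≥0∞) : (⨅ i, g i) ^ 2 = ⨅ i, g i ^ 2 := by
  have h := (ENNReal.orderIsoRpow 2 two_pos).map_iInf g
  simpa only [ENNReal.orderIsoRpow_apply, ENNReal.rpow_two] using h

theorem iInf_slFeasibleAt (E : ℕ) :
    (⨅ (K : Controller) (_ : SLFeasibleAt α β κ E K), systemNorm (closedLoop α β κ K)) ^ 2
      = ⨅ (f : Site E → LaurentSeries ℝ) (_ : f ∈ decisionSpace E), modelCost α β κ E f := by
  simp only [iInf_sq]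
  apply le_antisymm
  · refine le_iInf₂ fun f hf => ?_
    obtain ⟨K, hK, rfl⟩ := surjOn_parameter (α := α) (β := β) (κ := κ) E hf
    exact (iInf₂_le K hK).trans_eq (SLFeasibleAt.systemNorm_sq_eq hK)
  · refine le_iInf₂ fun K hK => ?_
    rw [hK.systemNorm_sq_eq]
    exact iInf₂_le _ (mapsTo_parameter E hK)

theorem iInf_slFeasible :
    (⨅ (K : Controller) (_ : SLFeasible α β κ K), systemNorm (closedLoop α β κ K)) ^ 2
      = ⨅ (E : ℕ) (f : Site E → LaurentSeries ℝ) (_ : f ∈ decisionSpace E),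
          modelCost α β κ E f := by
  simp only [← iInf_slFeasibleAt, ← iInf_sq]
  congr 1
  simp only [slFeasible_iff, iInf_exists]
  exact iInf_comm

/-! ### Finiteness and convexity -/

theorem Vdiag_mem_stableRational (q : CostMap) (d : ℤ) :
    Vdiag α β κ q d ∈ stableRational ℝ := by
  have hz : ∀ a : ℝ, zVar ℝ - const a ∈ stableRational ℝ := fun a =>
    sub_mem zVar_mem_stableRational (C_mem_stableRational a)
  have hc : ∀ a : ℝ, const a ∈ stableRational ℝ := C_mem_stableRational
  have h2 : (2 : LaurentSeries ℝ) ∈ stableRational ℝ := ofNat_mem _ 2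
  have hT := band_mem_stableRational (hz α) (neg_mem (hc (α * κ))) (zero_mem _) d
  have hI := band_mem_stableRational (one_mem (stableRational ℝ)) (zero_mem _) (zero_mem _) d
  cases q
  · exact mul_mem (hz β) hT
  · exact hI
  · exact mul_mem (pow_mem (hz β) 2) hT
  · exact mul_mem (hz β) hI
  · exact mul_mem (pow_mem (hz β) 2) (band_mem_stableRational
      (add_mem (pow_mem (hz α) 2) (mul_mem h2 (pow_mem (hc _) 2)))
      (neg_mem (mul_mem (mul_mem h2 (hc _)) (hz α))) (pow_mem (hc _) 2) d)
  · exact mul_mem (hz β) hT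

theorem hEntry_mem_stableRational (q : CostMap) (k : ℤ) :
    hEntry α β κ q k ∈ stableRational ℝ := by
  have hz : zVar ℝ - const β ∈ stableRational ℝ :=
    sub_mem zVar_mem_stableRational (C_mem_stableRational β)
  have hI := band_mem_stableRational (neg_mem (one_mem (stableRational ℝ)))
    (zero_mem _) (zero_mem _) k
  cases q
  · exact hI
  · exact zero_mem _
  · exact mul_mem hz hI
  · exact zero_mem _
  · exact mul_mem hz (band_mem_stableRational
      (sub_mem (C_mem_stableRational α) zVar_mem_stableRational) (C_mem_stableRational _)
      (zero_mem _) k)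
  · exact hI

theorem mulVec_mem_stableRational {m n : Type*} [Fintype n] {A : Matrix m n (LaurentSeries ℝ)}
    (hA : ∀ i j, A i j ∈ stableRational ℝ) {f : n → LaurentSeries ℝ}
    (hf : ∀ j, f j ∈ stableRational ℝ) (i : m) : A.mulVec f i ∈ stableRational ℝ :=
  sum_mem fun j _ => mul_mem (hA i j) (hf j)

theorem costVector_mem_stableRational {E : ℕ} {f : Site E → LaurentSeries ℝ}
    (hf : f ∈ decisionSpace E) (i : Row E) :
    ((VSL α β κ E).mulVec f + hSL α β κ E) i ∈ stableRational ℝ := by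
  rw [mulVec_VSL_add_hSL]
  refine add_mem (mulVec_mem_stableRational (fun i j => Vdiag_mem_stableRational _ _)
    (fun j => add_mem (mulVec_mem_stableRational (fun i j => ?_)
      (fun k => (mem_RHinf_iff.mp (hf k)).2) j) (gEntry_mem_stableRational _)) i)
    (hEntry_mem_stableRational _ _)
  unfold Smat
  rw [Matrix.of_apply]
  split_ifs
  · exact pow_mem inv_zVar_mem_stableRational 4
  · exact zero_mem _

theorem modelCost_ne_top {E : ℕ} {f : Site E → LaurentSeries ℝ} (hf : f ∈ decisionSpace E) :
    modelCost α β κ E f ≠ ⊤ := by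
  unfold modelCost columnNormSq
  refine ENNReal.sum_ne_top.mpr fun i _ => ?_
  exact (summable_sq_coeff (costVector_mem_stableRational hf i)).tsum_ofReal_ne_top

theorem columnNormSq_convex {ι : Type*} [Fintype ι] (v w : ι → LaurentSeries ℝ) {a b : ℝ}
    (ha : 0 ≤ a) (hb : 0 ≤ b) (hab : a + b = 1) :
    columnNormSq (a • v + b • w)
      ≤ ENNReal.ofReal a * columnNormSq v + ENNReal.ofReal b * columnNormSq w := by
  unfold columnNormSq
  rw [Finset.mul_sum, Finset.mul_sum, ← Finset.sum_add_distrib]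
  refine Finset.sum_le_sum fun i _ => ?_
  rw [← ENNReal.tsum_mul_left, ← ENNReal.tsum_mul_left, ← ENNReal.tsum_add]
  refine ENNReal.tsum_le_tsum fun t => ?_
  rw [← ENNReal.ofReal_mul ha, ← ENNReal.ofReal_mul hb,
    ← ENNReal.ofReal_add (by positivity) (by positivity)]
  refine ENNReal.ofReal_le_ofReal ?_
  have hcoeff : ((a • v + b • w) i).coeff t = a * (v i).coeff t + b * (w i).coeff t := by
    simp
  rw [hcoeff]
  have := (even_two.convexOn_pow (𝕜 := ℝ)).2 (Set.mem_univ ((v i).coeff t))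
    (Set.mem_univ ((w i).coeff t)) ha hb hab
  simpa using this

theorem costVector_affine {E : ℕ} (f g : Site E → LaurentSeries ℝ) {a b : ℝ} (hab : a + b = 1) :
    (VSL α β κ E).mulVec (a • f + b • g) + hSL α β κ E
      = a • ((VSL α β κ E).mulVec f + hSL α β κ E)
        + b • ((VSL α β κ E).mulVec g + hSL α β κ E) := by
  have hC : HahnSeries.C a + HahnSeries.C b = (1 : LaurentSeries ℝ) := by
    rw [← map_add, hab, map_one]
  funext i
  have hsum : ∑ j, VSL α β κ E i j * (HahnSeries.C a * f j + HahnSeries.C b * g j)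
      = HahnSeries.C a * ∑ j, VSL α β κ E i j * f j
        + HahnSeries.C b * ∑ j, VSL α β κ E i j * g j := by
    rw [Finset.mul_sum, Finset.mul_sum, ← Finset.sum_add_distrib]
    exact Finset.sum_congr rfl fun j _ => by ring
  simp only [Pi.add_apply, Pi.smul_apply, Matrix.mulVec, dotProduct, ← HahnSeries.C_mul_eq_smul,
    hsum]
  linear_combination (-hSL α β κ E i) * hC

theorem convex_decisionSpace (E : ℕ) : Convex ℝ (decisionSpace E) := by
  intro f hf g hg a b _ _ _ k
  have hf' := mem_RHinf_iff.mp (hf k)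
  have hg' := mem_RHinf_iff.mp (hg k)
  have hk : (a • f + b • g) k = HahnSeries.C a * f k + HahnSeries.C b * g k := by
    simp
  rw [hk, mem_RHinf_iff]
  refine ⟨fun t ht => ?_, add_mem (mul_mem (C_mem_stableRational _) hf'.2)
    (mul_mem (C_mem_stableRational _) hg'.2)⟩
  rw [HahnSeries.coeff_add, coeff_C_mul, coeff_C_mul, hf'.1 t ht, hg'.1 t ht]
  simp

theorem convexOn_modelCost (E : ℕ) :
    ConvexOn ℝ (decisionSpace E) (fun f => (modelCost α β κ E f).toReal) := by
  refine ⟨convex_decisionSpace E, fun f hf g hg a b ha hb hab => ?_⟩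
  have hft := modelCost_ne_top (α := α) (β := β) (κ := κ) hf
  have hgt := modelCost_ne_top (α := α) (β := β) (κ := κ) hg
  have hle : modelCost α β κ E (a • f + b • g)
      ≤ ENNReal.ofReal a * modelCost α β κ E f + ENNReal.ofReal b * modelCost α β κ E g := by
    unfold modelCost
    rw [costVector_affine f g hab]
    exact columnNormSq_convex _ _ ha hb hab
  have h1 : ENNReal.ofReal a * modelCost α β κ E f ≠ ⊤ := ENNReal.mul_ne_top (by simp) hft
  have h2 : ENNReal.ofReal b * modelCost α β κ E g ≠ ⊤ := ENNReal.mul_ne_top (by simp) hgt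
  have h := ENNReal.toReal_mono (ENNReal.add_ne_top.mpr ⟨h1, h2⟩) hle
  rw [ENNReal.toReal_add h1 h2, ENNReal.toReal_mul, ENNReal.toReal_mul, ENNReal.toReal_ofReal ha,
    ENNReal.toReal_ofReal hb] at h
  exact h

end Cost

end SpatialSL

end

open SpatialSL in
theorem mainTheorem1 (α β κ : ℝ) :
    -- feasibility means feasibility at some finite extent `E` of the parameter
    (∀ K : Controller, SLFeasible α β κ K ↔ ∃ E : ℕ, SLFeasibleAt α β κ E K) ∧
    -- the optimal values agree
    ((⨅ (K : Controller) (_ : SLFeasible α β κ K), systemNorm (closedLoop α β κ K)) ^ 2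
      = ⨅ (E : ℕ) (f : Site E → LaurentSeries ℝ) (_ : f ∈ decisionSpace E),
          modelCost α β κ E f) ∧
    ∀ E : ℕ,
      -- controllers and decision variables correspond one to one, with equal cost
      Set.BijOn (fun K (k : Site E) => parameter α β κ K k)
        {K : Controller | SLFeasibleAt α β κ E K} (decisionSpace E) ∧
      (∀ K : Controller, SLFeasibleAt α β κ E K →
        systemNorm (closedLoop α β κ K) ^ 2
          = modelCost α β κ E (fun k : Site E => parameter α β κ K k)) ∧
      ((⨅ (K : Controller) (_ : SLFeasibleAt α β κ E K), systemNorm (closedLoop α β κ K)) ^ 2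
        = ⨅ (f : Site E → LaurentSeries ℝ) (_ : f ∈ decisionSpace E), modelCost α β κ E f) ∧
      -- the extents of the closed-loop maps
      (∀ K : Controller, SLFeasibleAt α β κ E K →
        SLExtentBounds α β κ (max (E + 1) 2) (max (E + 2) 3) K) ∧
      (1 ≤ E → α * κ ≠ 0 → ∀ K : Controller,
        (SLFeasibleAt α β κ E K ↔
          InternallyStabilizing α β κ K ∧ SLExtentBounds α β κ (E + 1) (E + 2) K)) ∧
      -- the model-matching problem is finite and convex
      (∀ f ∈ decisionSpace E, modelCost α β κ E f ≠ ⊤) ∧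
      ConvexOn ℝ (decisionSpace E) (fun f => (modelCost α β κ E f).toReal) := by
  exact ⟨fun _ => slFeasible_iff, iInf_slFeasible, fun E => ⟨bijOn_parameter E,
    fun _ hK => hK.systemNorm_sq_eq, iInf_slFeasibleAt E, fun _ hK => hK.slExtentBounds,
    fun hE hακ _ => slFeasibleAt_iff_slExtentBounds hE hακ, fun _ hf => modelCost_ne_top hf,
    convexOn_modelCost E⟩⟩
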